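/- Let $0<\theta<1$, $h>0$, $M\in\mathbb N\setminus\{0\}$, and let $2_\theta^*:=2/(1-2\theta)_+\in(2,\infty]$ (so $2^*_\theta=\infty$ if $2\theta\ge 1$). Let $q\in(1,\infty)$ with $q\le 2_\theta^*$. For real $x$ and $p>0$ write $x^{p}:=|x|^{p-1}x$ (odd power) when a power of a possibly negative number occurs, and $a_+:=\max(a,0)$. Weights. Let $C_{1,\theta}=\dfrac{2\theta\,2^{2\theta-1}\Gamma(\frac{1+2\theta}{2})}{\pi^{1/2}\Gamma(\frac{2-2\theta}{2})}$, let $G(t)=\dfrac{C_{1,\theta}}{(2-2\theta)(2\theta-1)2\theta}|t|^{2-2\theta}$ if $2\theta\ne1$ and $G(t)=C_{1,\theta}(t-t\log|t|)$ if $2\theta=1$. Let $(w_j^h)_{j\in\mathbb Z}$ be the symmetric Huang–Oberman weights, $w_{-j}^h=w_j^h$, given for $j\ge1$ by $$w_j^h=h^{-2\theta}\begin{cases}\frac{C_{1,\theta}}{2-2\theta}-G''(1)-\frac{G'(3)+3G'(1)}{2}+G(3)-G(1),&j=1,\\ 2\,[G'(j+1)+G'(j-1)-G(j+1)+G(j-1)],&j=2,4,6,\dots,\\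 -\frac{G'(j+2)+6G'(j)+G'(j-2)}{2}+G(j+2)-G(j-2),&j=3,5,7,\dots\end{cases}$$ (the value $w_0^h$ plays no role). For $\mathbf f=(f_i)_{i\in\mathbb Z}$ put $$[(-\Delta)_h^\theta\mathbf f]_i=\sum_{j\in\mathbb Z}w_j^h(f_i-f_{i-j}),\quad \|\mathbf f\|_{\ell^q_h}=\Big(\sum_{i\in\mathbb Z}h|f_i|^q\Big)^{1/q},\quad [\mathbf f]_{H^\theta_h}=\Big(\tfrac12\sum_{i,j\in\mathbb Z}h\,w_j^h|f_i-f_{i-j}|^2\Big)^{1/2},$$ and $R(\mathbf f)=[\mathbf f]_{H^\theta_h}^2/\|\mathbf f\|_{\ell^q_h}^2$ for $\mathbf f\neq 0$. Let $\mathbf u^0\in\mathbb R^{\mathbb Z}$ with $\mathbf u^0\not\equiv0$ and $u^0_i=0$ for $|i|>M$. Let $C>0$ be any constant such that $\|\mathbf f\|_{\ell^q_h}\le C[\mathbf f]_{H^\theta_h}$ for all $\mathbf f$ with $f_i=0$ for $|i|>M$ and $[\mathbf f]_{H^\theta_h}<\infty$. Let $\mathbf v(t)=(v_i(t))_{i\in\mathbb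 Z}$, $t\ge0$, be the solution of the semi-discrete scheme $$\frac{d}{dt}v_i^{q-1}(t)+[(-\Delta)_h^\theta\mathbf v(t)]_i=0\ \ (|i|\le M,\ \text{a.e. }t>0),\qquad v_i(t)=0\ \ (|i|>M,\ t\ge0),\qquad v_i(0)=u_i^0\ \ (|i|\le M),$$ with $v_i^{q-1}\in W^{1,1}(0,T)$ for every $T>0$ and $i\in\mathbb Z$ (absolutely continuous representative). Then: 1. If $q\ne2$, then for every $t>0$ $$\Big(\|\mathbf u^0\|_{\ell^q_h}^{-(2-q)}+\tfrac{2-q}{q-1}R(\mathbf u^0)t\Big)_+^{\frac{-1}{2-q}}\le\|\mathbf v(t)\|_{\ell^q_h}\le\Big(\|\mathbf u^0\|_{\ell^q_h}^{-(2-q)}+\tfrac{2-q}{q-1}C^{-2}t\Big)_+^{\frac{-1}{2-q}}.$$ 2. If $q>2$, there is an extinction time $t_*^h\in(0,\infty)$, i.e. for $t\ge 0$, $\mathbf v(t)\equiv0$ if and only if $t\ge t_*^h$, such that for every $t>0$ $$\Big(\tfrac{q-2}{q-1}C^{-2}(t_*^h-t)\Big)_+^{\frac1{q-2}}\le\|\mathbf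 v(t)\|_{\ell^q_h}\le\Big(\tfrac{q-2}{q-1}R(\mathbf u^0)(t_*^h-t)\Big)_+^{\frac1{q-2}}.$$ 3. If $q\le2$, then $\mathbf v(t)\not\equiv0$ for all $t\ge0$ and $t\mapsto R(\mathbf v(t))$ is non-increasing on $[0,\infty)$. If $q>2$, then $t\mapsto R(\mathbf v(t))$ is non-increasing on $[0,t_*^h)$. -/

import Mathlib

open Set MeasureTheory

noncomputable section

namespace FracDiff

/-- The odd power `x ^ p := |x| ^ (p - 1) x`. -/
def oddPow (x p : ℝ) : ℝ := |x| ^ (p - 1) * x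

/-- The critical exponent `2 / (1 - 2 θ)₊` in dimension one, equal to `∞` when `2 θ ≥ 1`. -/
def twoStar (θ : ℝ) : ENNReal := 2 / ENNReal.ofReal (1 - 2 * θ)

/-- The normalising constant of the fractional Laplacian of order `θ` in dimension one. -/
def fracLapConst (θ : ℝ) : ℝ :=
  2 * θ * 2 ^ (2 * θ - 1) * Real.Gamma ((1 + 2 * θ) / 2) /
    (Real.pi ^ (1 / 2 : ℝ) * Real.Gamma ((2 - 2 * θ) / 2))

/-- The auxiliary function of Huang and Oberman. -/
def auxG (θ t : ℝ) : ℝ :=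
  if 2 * θ = 1 then fracLapConst θ * (t - t * Real.log |t|)
  else fracLapConst θ / ((2 - 2 * θ) * (2 * θ - 1) * (2 * θ)) * |t| ^ (2 - 2 * θ)

/-- The Huang--Oberman weights for `h = 1`, as a function of `n = |j|`. The weight at `n = 0`
is irrelevant, since it is only ever multiplied by `f i - f i`. -/
def unitWeight (θ : ℝ) (n : ℕ) : ℝ :=
  if n = 0 then 0
  else if n = 1 then
    fracLapConst θ / (2 - 2 * θ) - deriv (deriv (auxG θ)) 1
      - (deriv (auxG θ) 3 + 3 * deriv (auxG θ) 1) / 2 + auxG θ 3 - auxG θ 1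
  else if Even n then
    2 * (deriv (auxG θ) ((n : ℝ) + 1) + deriv (auxG θ) ((n : ℝ) - 1)
      - auxG θ ((n : ℝ) + 1) + auxG θ ((n : ℝ) - 1))
  else
    -(deriv (auxG θ) ((n : ℝ) + 2) + 6 * deriv (auxG θ) (n : ℝ)
        + deriv (auxG θ) ((n : ℝ) - 2)) / 2
      + auxG θ ((n : ℝ) + 2) - auxG θ ((n : ℝ) - 2)

/-- The symmetric weights `w_j^h` of the discrete fractional Laplacian. -/
def weight (θ h : ℝ) (j : ℤ) : ℝ := h ^ (-(2 * θ)) * unitWeight θ j.natAbs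

/-- The discrete fractional Laplacian `∑_j w_j^h (f_i - f_{i-j})`. -/
def discFracLap (θ h : ℝ) (f : ℤ → ℝ) (i : ℤ) : ℝ :=
  ∑' j : ℤ, weight θ h j * (f i - f (i - j))

/-- The discrete Lebesgue norm `(∑_i h |f_i|^q)^{1/q}`. -/
def lqNorm (q h : ℝ) (f : ℤ → ℝ) : ℝ := (∑' i : ℤ, h * |f i| ^ q) ^ (1 / q)

/-- The discrete fractional Sobolev seminorm
`(1/2 ∑_{i,j} h w_j^h |f_i - f_{i-j}|^2)^{1/2}`. -/
def hSeminorm (θ h : ℝ) (f : ℤ → ℝ) : ℝ :=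
  Real.sqrt (1 / 2 * ∑' p : ℤ × ℤ, h * weight θ h p.2 * |f p.1 - f (p.1 - p.2)| ^ 2)

/-- The sequences that vanish outside the grid and have a finite Sobolev seminorm. -/
def spaceX (θ h : ℝ) (M : ℕ) : Set (ℤ → ℝ) :=
  {f | (∀ i : ℤ, (M : ℤ) < |i| → f i = 0) ∧
    Summable fun p : ℤ × ℤ => h * weight θ h p.2 * |f p.1 - f (p.1 - p.2)| ^ 2}

/-- `C` is a constant in the discrete Poincaré--Sobolev inequality. -/
def IsPoincareSobolevConst (θ q h : ℝ) (M : ℕ) (C : ℝ) : Prop :=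
  ∀ f ∈ spaceX θ h M, lqNorm q h f ≤ C * hSeminorm θ h f

/-- The discrete Rayleigh quotient. -/
def rayleigh (θ q h : ℝ) (f : ℤ → ℝ) : ℝ := hSeminorm θ h f ^ 2 / lqNorm q h f ^ 2

/-- `v` (of which only the values at times `t ≥ 0` matter) solves the semi-discrete scheme with
initial datum `u₀`. The condition that the power of order `q - 1` of `v_i` is in `W^{1,1}(0,T)` for
every `T > 0` is expressed for the absolutely continuous representative, the one for which
`v_i(0)` has a meaning, and the differential equation holds at almost every time. -/
structure IsSolution (θ q h : ℝ) (M : ℕ) (u₀ : ℤ → ℝ) (v : ℝ → ℤ → ℝ) : Prop where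
  absCont : ∀ (i : ℤ) (T : ℝ), 0 < T →
    AbsolutelyContinuousOnInterval (fun t => oddPow (v t i) (q - 1)) 0 T
  ode : ∀ i : ℤ, |i| ≤ (M : ℤ) → ∀ᵐ t ∂(volume.restrict (Ioi (0 : ℝ))),
    HasDerivAt (fun s => oddPow (v s i) (q - 1)) (-discFracLap θ h (v t) i) t
  boundary : ∀ i : ℤ, (M : ℤ) < |i| → ∀ t : ℝ, 0 ≤ t → v t i = 0
  initial : ∀ i : ℤ, |i| ≤ (M : ℤ) → v 0 i = u₀ i

end FracDiff

end

open Set MeasureTheory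

noncomputable section

namespace FracDiff

/-! With v = 0 outside the grid, the scheme is a finite system (v^(q-1))' = -Av with A the symmetric
matrix `stiffness`. Put E = h⟨Av, v⟩ and N = ∑ h|v_i|^q. Then R = E N^(-2/q) where N > 0, and N' =
-(q/(q-1)) E = -(q/(q-1)) R N^(2/q). Hence, as long as N > 0, N^((q-2)/q) = ‖v‖^(q-2) has derivative
-((q-2)/(q-1)) R. The decay and extinction bounds follow from C^(-2) ≤ R(v(t)) ≤ R(u⁰): the left
inequality is Poincaré–Sobolev, the right one is the monotonicity of R.

Formally E' = -(2/(q-1)) h ∑ |v_i|^(2-q) (Av)_i², and Cauchy–Schwarz bounds E² by N times the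
weighted sum (`energy_sq_le`), so (E N^(-2/q))' ≤ 0. The obstacle is that for q > 2 a component may
fail to be differentiable where it vanishes. Since A is positive semidefinite, E is convex and
E(v(t)) - E(v(s)) ≤ 2h⟨Av(t), v(t) - v(s)⟩ (`energy_sub_le`). If v_i(t) = 0 and (Av(t))_i ≠ 0, then
v_i(s) has the sign of (Av(t))_i for s slightly below t, so that term only helps
(`exists_left_bound`). A left Dini derivative argument then suffices (`IsFlow.antitoneOn_quotient`).

Semidefiniteness rests on the weights being summable and nonnegative. Away from the origin they are
integrals of quadratic Lagrange basis functions against G''' = c t^(-1-2θ). Those functions change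
sign on the cells next to odd nodes, so `unitWeight_nonneg` needs a real argument. -/

open Filter Topology

/-! ### Quadrature errors and summability of the weights -/

section Quadrature

variable {F F₁ F₂ F₃ : ℝ → ℝ} {n r K : ℝ}

theorem abs_secondDifference_le (hr : 0 ≤ r)
    (h₁ : ∀ x ∈ Icc (n - r) (n + r), HasDerivAt F₁ (F₂ x) x)
    (h₂ : ∀ x ∈ Icc (n - r) (n + r), ∀ y ∈ Icc (n - r) (n + r), |F₂ x - F₂ y| ≤ K * |x - y|)
    (hK : 0 ≤ K) :
    |F₁ (n + r) + F₁ (n - r) - 2 * F₁ n| ≤ 2 * K * r ^ 2 := by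
  have key := norm_image_sub_le_of_norm_deriv_le_segment' (a := 0) (b := r) (C := 2 * K * r)
    (f := fun s => F₁ (n + s) + F₁ (n - s)) (f' := fun s => F₂ (n + s) - F₂ (n - s)) ?_ ?_ r
    ⟨hr, le_rfl⟩
  · simp only [Real.norm_eq_abs, add_zero, sub_zero] at key
    calc _ = |F₁ (n + r) + F₁ (n - r) - (F₁ n + F₁ n)| := by ring_nf
      _ ≤ _ := key
      _ = _ := by ring
  · intro s hs
    have a₁ := (h₁ (n + s) ⟨by linarith [hs.1], by linarith [hs.2]⟩).comp_const_add n s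
    have a₂ := (h₁ (n - s) ⟨by linarith [hs.2], by linarith [hs.1]⟩).comp_const_sub n s
    exact ((a₁.fun_add a₂).congr_deriv (by ring)).hasDerivWithinAt
  · intro s hs
    have := h₂ (n + s) ⟨by linarith [hs.1], by linarith [hs.2]⟩ (n - s)
      ⟨by linarith [hs.2], by linarith [hs.1]⟩
    rw [show n + s - (n - s) = 2 * s by ring,
      abs_of_nonneg (show (0 : ℝ) ≤ 2 * s by linarith [hs.1])] at this
    rw [Real.norm_eq_abs]
    refine this.trans ?_
    nlinarith [hs.2, hs.1]

/-- Differentiating the error in the half-width s cancels everything except s (F₂(n+s) - F₂(n-s)),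
which the Lipschitz bound controls. -/
theorem abs_trapezoid_error_le (hr : 0 ≤ r)
    (h₀ : ∀ x ∈ Icc (n - r) (n + r), HasDerivAt F (F₁ x) x)
    (h₁ : ∀ x ∈ Icc (n - r) (n + r), HasDerivAt F₁ (F₂ x) x)
    (h₂ : ∀ x ∈ Icc (n - r) (n + r), ∀ y ∈ Icc (n - r) (n + r), |F₂ x - F₂ y| ≤ K * |x - y|)
    (hK : 0 ≤ K) :
    |r * (F₁ (n + r) + F₁ (n - r)) - (F (n + r) - F (n - r))| ≤ 2 * K * r ^ 3 := by
  have key := norm_image_sub_le_of_norm_deriv_le_segment' (a := 0) (b := r) (C := 2 * K * r ^ 2)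
    (f := fun s => s * (F₁ (n + s) + F₁ (n - s)) - (F (n + s) - F (n - s)))
    (f' := fun s => s * (F₂ (n + s) - F₂ (n - s))) ?_ ?_ r ⟨hr, le_rfl⟩
  · simp only [Real.norm_eq_abs, add_zero, sub_zero, zero_mul, sub_self] at key
    calc _ ≤ _ := key
      _ = _ := by ring
  · intro s hs
    have m₁ : n + s ∈ Icc (n - r) (n + r) := ⟨by linarith [hs.1], by linarith [hs.2]⟩
    have m₂ : n - s ∈ Icc (n - r) (n + r) := ⟨by linarith [hs.2], by linarith [hs.1]⟩
    have a₁ := (h₁ _ m₁).comp_const_add n s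
    have a₂ := (h₁ _ m₂).comp_const_sub n s
    have b₁ := (h₀ _ m₁).comp_const_add n s
    have b₂ := (h₀ _ m₂).comp_const_sub n s
    refine ((((hasDerivAt_id' s).fun_mul (a₁.fun_add a₂)).fun_sub
      (b₁.fun_sub b₂)).congr_deriv ?_).hasDerivWithinAt
    ring
  · intro s hs
    have := h₂ (n + s) ⟨by linarith [hs.1], by linarith [hs.2]⟩ (n - s)
      ⟨by linarith [hs.2], by linarith [hs.1]⟩
    rw [show n + s - (n - s) = 2 * s by ring,
      abs_of_nonneg (show (0 : ℝ) ≤ 2 * s by linarith [hs.1])] at this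
    rw [Real.norm_eq_abs, abs_mul, abs_of_nonneg hs.1]
    calc s * |F₂ (n + s) - F₂ (n - s)| ≤ r * (K * (2 * r)) := by
          gcongr
          · exact hs.2.le
          · exact this.trans (by gcongr; exact hs.2.le)
      _ = _ := by ring

end Quadrature

/-- The first derivative of `auxG` on the positive half-line. -/
def auxG₁ (θ t : ℝ) : ℝ :=
  if 2 * θ = 1 then -fracLapConst θ * Real.log t
  else fracLapConst θ / ((2 * θ - 1) * (2 * θ)) * t ^ (1 - 2 * θ)

/-- The second derivative of `auxG` on the positive half-line. -/
def auxG₂ (θ t : ℝ) : ℝ := -(fracLapConst θ / (2 * θ)) * t ^ (-(2 * θ))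

variable {θ h t : ℝ}

theorem hasDerivAt_auxG (hθ' : θ < 1) (ht : 0 < t) : HasDerivAt (auxG θ) (auxG₁ θ t) t := by
  unfold auxG₁
  by_cases h1 : 2 * θ = 1
  · have := (((hasDerivAt_id' t).fun_sub ((hasDerivAt_id' t).fun_mul (Real.hasDerivAt_log ht.ne'))).const_mul
      (fracLapConst θ))
    have e : auxG θ =ᶠ[nhds t] fun t => fracLapConst θ * (t - t * Real.log t) :=
      .of_forall fun s => by simp [auxG, h1]
    rw [if_pos h1]
    refine (this.congr_of_eventuallyEq e).congr_deriv ?_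
    field_simp
    ring
  · have := (Real.hasDerivAt_rpow_const (x := t) (p := 2 - 2 * θ) (Or.inl ht.ne')).const_mul
      (fracLapConst θ / ((2 - 2 * θ) * (2 * θ - 1) * (2 * θ)))
    have e : auxG θ =ᶠ[nhds t] fun t =>
        fracLapConst θ / ((2 - 2 * θ) * (2 * θ - 1) * (2 * θ)) * t ^ (2 - 2 * θ) := by
      filter_upwards [lt_mem_nhds ht] with s hs
      simp [auxG, h1, abs_of_pos hs]
    rw [if_neg h1]
    refine (this.congr_of_eventuallyEq e).congr_deriv ?_
    have h2 : 1 - θ ≠ 0 := by linarith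
    have h5 : 2 - 2 * θ ≠ 0 := by linarith
    rw [show 2 - 2 * θ - 1 = 1 - 2 * θ by ring]
    generalize t ^ (1 - 2 * θ) = z
    by_cases h3 : θ = 0
    · simp [h3]
    have h4 : 2 * θ - 1 ≠ 0 := sub_ne_zero.2 h1
    field_simp

theorem hasDerivAt_auxG₁ (hθ : 0 < θ) (ht : 0 < t) : HasDerivAt (auxG₁ θ) (auxG₂ θ t) t := by
  unfold auxG₂
  by_cases h1 : 2 * θ = 1
  · have := (Real.hasDerivAt_log ht.ne').const_mul (-fracLapConst θ)
    have e : auxG₁ θ = fun t => -fracLapConst θ * Real.log t := by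
      funext s; simp [auxG₁, h1]
    rw [e, h1]
    simpa [Real.rpow_neg_one] using this
  · have := (Real.hasDerivAt_rpow_const (x := t) (p := 1 - 2 * θ) (Or.inl ht.ne')).const_mul
      (fracLapConst θ / ((2 * θ - 1) * (2 * θ)))
    have e : auxG₁ θ = fun t => fracLapConst θ / ((2 * θ - 1) * (2 * θ)) * t ^ (1 - 2 * θ) := by
      funext s; simp [auxG₁, h1]
    rw [e]
    refine this.congr_deriv ?_
    have h4 : 2 * θ - 1 ≠ 0 := sub_ne_zero.2 h1
    rw [show 1 - 2 * θ - 1 = -(2 * θ) by ring]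
    generalize t ^ (-(2 * θ)) = z
    field_simp
    ring

theorem deriv_auxG (hθ' : θ < 1) (ht : 0 < t) : deriv (auxG θ) t = auxG₁ θ t :=
  (hasDerivAt_auxG hθ' ht).deriv

theorem hasDerivAt_auxG₂ (hθ : 0 < θ) (ht : 0 < t) :
    HasDerivAt (auxG₂ θ) (fracLapConst θ * t ^ (-(2 * θ) - 1)) t := by
  have := (Real.hasDerivAt_rpow_const (x := t) (p := -(2 * θ)) (Or.inl ht.ne')).const_mul
      (-(fracLapConst θ / (2 * θ)))
  refine this.congr_deriv ?_
  field_simp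

theorem abs_auxG₂_sub_le (hθ : 0 < θ) {a x y : ℝ} (ha : 0 < a) (hx : a ≤ x) (hy : a ≤ y) :
    |auxG₂ θ x - auxG₂ θ y| ≤ |fracLapConst θ| * a ^ (-(2 * θ) - 1) * |x - y| := by
  refine (convex_Ici a).norm_image_sub_le_of_norm_hasDerivWithin_le
    (f' := fun t => fracLapConst θ * t ^ (-(2 * θ) - 1))
    (fun z hz => (hasDerivAt_auxG₂ hθ (ha.trans_le hz)).hasDerivWithinAt) (fun z hz => ?_) hy hx
  have hz' : 0 < z := ha.trans_le hz
  rw [norm_mul, Real.norm_eq_abs, Real.norm_eq_abs,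
    abs_of_nonneg (Real.rpow_nonneg hz'.le (-(2 * θ) - 1))]
  exact mul_le_mul_of_nonneg_left
    (Real.rpow_le_rpow_of_nonpos ha hz (by linarith)) (abs_nonneg _)

/-- An even weight is twice a trapezoid error T of half-width 1. An odd one is -T + (3/2)T', with T
a trapezoid error and T' a second difference of G', both of half-width 2. The Lipschitz constant of
G'' is taken at the left end n - 2 = m + 1. The two cases give 4K and 28K, so 32 is merely
convenient. -/
theorem abs_unitWeight_le (hθ : 0 < θ) (hθ' : θ < 1) (m : ℕ) :
    |unitWeight θ (m + 3)| ≤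
      32 * (|fracLapConst θ| * ((m + 1 : ℕ) : ℝ) ^ (-(2 * θ) - 1)) := by
  set K := |fracLapConst θ| * ((m + 1 : ℕ) : ℝ) ^ (-(2 * θ) - 1) with hK
  have hK0 : 0 ≤ K := by positivity
  set n : ℝ := ((m + 3 : ℕ) : ℝ) with hn
  have hm0 : (0 : ℝ) < ((m + 1 : ℕ) : ℝ) := by positivity
  have hmn : n - 2 = ((m + 1 : ℕ) : ℝ) := by rw [hn]; push_cast; ring
  have pos : ∀ r ≤ (2 : ℝ), ∀ x ∈ Icc (n - r) (n + r), ((m + 1 : ℕ) : ℝ) ≤ x := fun r hr x hx => by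
    linarith [hx.1]
  have H₀ : ∀ r ≤ (2 : ℝ), ∀ x ∈ Icc (n - r) (n + r), HasDerivAt (auxG θ) (auxG₁ θ x) x :=
    fun r hr x hx => hasDerivAt_auxG hθ' (hm0.trans_le (pos r hr x hx))
  have H₁ : ∀ r ≤ (2 : ℝ), ∀ x ∈ Icc (n - r) (n + r), HasDerivAt (auxG₁ θ) (auxG₂ θ x) x :=
    fun r hr x hx => hasDerivAt_auxG₁ hθ (hm0.trans_le (pos r hr x hx))
  have H₂ : ∀ r ≤ (2 : ℝ), ∀ x ∈ Icc (n - r) (n + r), ∀ y ∈ Icc (n - r) (n + r),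
      |auxG₂ θ x - auxG₂ θ y| ≤ K * |x - y| := fun r hr x hx y hy =>
    abs_auxG₂_sub_le hθ hm0 (pos r hr x hx) (pos r hr y hy)
  have D : ∀ x : ℝ, n - 2 ≤ x → deriv (auxG θ) x = auxG₁ θ x := fun x hx =>
    deriv_auxG hθ' (by linarith)
  unfold unitWeight
  rw [if_neg (by omega), if_neg (by omega)]
  split_ifs with he
  · have T := abs_trapezoid_error_le (n := n) (r := 1) zero_le_one (H₀ 1 (by norm_num))
      (H₁ 1 (by norm_num)) (H₂ 1 (by norm_num)) hK0
    rw [← hn, D _ (by linarith), D _ (by linarith)]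
    rw [abs_le] at T ⊢
    constructor <;> linarith [T.1, T.2]
  · have T := abs_trapezoid_error_le (n := n) (r := 2) zero_le_two (H₀ 2 le_rfl)
      (H₁ 2 le_rfl) (H₂ 2 le_rfl) hK0
    have T' := abs_secondDifference_le (n := n) (r := 2) zero_le_two
      (H₁ 2 le_rfl) (H₂ 2 le_rfl) hK0
    rw [← hn, D _ (by linarith), D _ (by linarith), D _ (by linarith)]
    rw [abs_le] at T T' ⊢
    constructor <;> linarith [T.1, T.2, T'.1, T'.2]

theorem summable_weight (hθ : 0 < θ) (hθ' : θ < 1) (h : ℝ) : Summable (weight θ h) := by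
  have s₁ : Summable fun m : ℕ => ((m + 1 : ℕ) : ℝ) ^ (-(2 * θ) - 1) :=
    (summable_nat_add_iff 1).2 (Real.summable_nat_rpow.2 (by linarith))
  have s₂ : Summable (unitWeight θ) := by
    rw [← summable_nat_add_iff 3]
    refine Summable.of_norm_bounded ((s₁.mul_left |fracLapConst θ|).mul_left 32) fun m => ?_
    exact abs_unitWeight_le hθ hθ' m
  refine Summable.mul_left _ (Summable.of_nat_of_neg ?_ ?_)
  · simpa using s₂
  · simpa using s₂

theorem weight_neg (θ h : ℝ) (j : ℤ) : weight θ h (-j) = weight θ h j := by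
  simp [weight]

/-! ### Nonnegativity of the weights -/

section Positivity

variable {θ : ℝ}

theorem fracLapConst_pos (hθ : 0 < θ) (hθ' : θ < 1) : 0 < fracLapConst θ := by
  have h₁ := Real.Gamma_pos_of_pos (s := (1 + 2 * θ) / 2) (by linarith)
  have h₂ := Real.Gamma_pos_of_pos (s := (2 - 2 * θ) / 2) (by linarith)
  have := Real.pi_pos
  unfold fracLapConst
  positivity

/-- A primitive of the product of the quadratic kernel `k (t - α) (t - β)` with the third derivative
of `auxG`. -/
def kernelPrimitive (θ k α β t : ℝ) : ℝ :=
  k * ((t - α) * (t - β)) * auxG₂ θ t - k * (2 * t - α - β) * auxG₁ θ t + 2 * k * auxG θ t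

theorem hasDerivAt_kernelPrimitive (hθ : 0 < θ) (hθ' : θ < 1) (k α β : ℝ) {t : ℝ} (ht : 0 < t) :
    HasDerivAt (kernelPrimitive θ k α β)
      (k * ((t - α) * (t - β)) * (fracLapConst θ * t ^ (-(2 * θ) - 1))) t := by
  have hi := hasDerivAt_id' t
  have h₁ := (((hi.sub_const α).fun_mul (hi.sub_const β)).const_mul k).fun_mul
    (hasDerivAt_auxG₂ hθ ht)
  have h₂ := (((((hi.const_mul 2).sub_const α).sub_const β).const_mul k)).fun_mul
    (hasDerivAt_auxG₁ hθ ht)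
  have h₃ := (hasDerivAt_auxG hθ' ht).const_mul (2 * k)
  exact ((h₁.fun_sub h₂).fun_add h₃).congr_deriv (by ring)

/-- Comparison of two integrals phrased through primitives: a pointwise lower bound r p for the
kernel times t^(-2θ-1) makes the difference of the primitives monotone. It is used with t^(-2θ-1),
wholly or in part, frozen to a constant r. -/
theorem sub_le_kernelPrimitive_sub (hθ : 0 < θ) (hθ' : θ < 1) (k α β : ℝ) {a b r : ℝ}
    {P p : ℝ → ℝ} (ha : 0 < a) (hab : a ≤ b)
    (hP : ∀ t ∈ Icc a b, HasDerivAt P (p t) t)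
    (hp : ∀ t ∈ Icc a b, r * p t ≤ k * ((t - α) * (t - β)) * t ^ (-(2 * θ) - 1)) :
    fracLapConst θ * r * (P b - P a)
      ≤ kernelPrimitive θ k α β b - kernelPrimitive θ k α β a := by
  have hd : ∀ t ∈ Icc a b, HasDerivAt
      (fun t => kernelPrimitive θ k α β t - fracLapConst θ * r * P t)
      (k * ((t - α) * (t - β)) * (fracLapConst θ * t ^ (-(2 * θ) - 1))
        - fracLapConst θ * r * p t) t := fun t ht =>
    (hasDerivAt_kernelPrimitive hθ hθ' k α β (ha.trans_le ht.1)).fun_sub ((hP t ht).const_mul _)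
  have hm : MonotoneOn (fun t => kernelPrimitive θ k α β t - fracLapConst θ * r * P t)
      (Icc a b) := by
    refine monotoneOn_of_deriv_nonneg (convex_Icc a b)
      (fun t ht => (hd t ht).continuousAt.continuousWithinAt)
      (fun t ht => (hd t (interior_subset ht)).differentiableAt.differentiableWithinAt)
      fun t ht => ?_
    rw [(hd t (interior_subset ht)).deriv]
    have := mul_le_mul_of_nonneg_left (hp t (interior_subset ht)) (fracLapConst_pos hθ hθ').le
    linarith
  have := hm ⟨le_rfl, hab⟩ ⟨hab, le_rfl⟩ hab
  simp only at this
  linarith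

theorem hasDerivAt_cubic (k α β t : ℝ) :
    HasDerivAt (fun t : ℝ => k * (t ^ 3 / 3 - (α + β) * t ^ 2 / 2 + α * β * t))
      (k * ((t - α) * (t - β))) t := by
  have h₁ := (hasDerivAt_pow 3 t).div_const 3
  have h₂ := ((hasDerivAt_pow 2 t).const_mul (α + β)).div_const 2
  have h₃ := (hasDerivAt_id' t).const_mul (α * β)
  refine (((h₁.fun_sub h₂).fun_add h₃).const_mul k).congr_deriv ?_
  push_cast
  ring

/-- The kernel is positive on the left half of the cell and negative on the right half, while
t^(-2θ-1) decreases. Freezing that factor at the sign change m + 1 lowers the integral, and the bare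
kernel has integral 1/3. -/
theorem kernelPrimitive_sub_nonneg (hθ : 0 < θ) (hθ' : θ < 1) {m : ℝ} (hm : 0 < m) :
    0 ≤ kernelPrimitive θ (1 / 2) (m + 1) (m + 2) (m + 2)
      - kernelPrimitive θ (1 / 2) (m + 1) (m + 2) m := by
  refine le_trans ?_ (sub_le_kernelPrimitive_sub hθ hθ' (1 / 2) (m + 1) (m + 2)
    (r := (m + 1) ^ (-(2 * θ) - 1)) hm (by linarith)
    (fun t _ => hasDerivAt_cubic (1 / 2) (m + 1) (m + 2) t) fun t ht => ?_)
  · have := (fracLapConst_pos hθ hθ').le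
    have e : 0 ≤ 1 / 2 * ((m + 2) ^ 3 / 3 - (m + 1 + (m + 2)) * (m + 2) ^ 2 / 2
        + (m + 1) * (m + 2) * (m + 2))
        - 1 / 2 * (m ^ 3 / 3 - (m + 1 + (m + 2)) * m ^ 2 / 2 + (m + 1) * (m + 2) * m) := by
      ring_nf
      norm_num
    positivity
  · have ht0 : 0 < t := hm.trans_le ht.1
    rw [mul_comm]
    rcases le_total t (m + 1) with h | h
    · refine mul_le_mul_of_nonneg_left
        (Real.rpow_le_rpow_of_nonpos ht0 h (by linarith)) ?_
      exact mul_nonneg (by norm_num)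
        (mul_nonneg_of_nonpos_of_nonpos (by linarith) (by linarith [ht.2]))
    · refine mul_le_mul_of_nonpos_left
        (Real.rpow_le_rpow_of_nonpos (by linarith) h (by linarith)) ?_
      exact mul_nonpos_of_nonneg_of_nonpos (by norm_num)
        (mul_nonpos_of_nonneg_of_nonpos (by linarith) (by linarith [ht.2]))

/-- Here the kernel is negative where t^(-2θ-1) is largest. Its two halves integrate to -1/12 and
5/12, so it is enough that t^(-2θ-1) varies by a factor at most 5 over the cell; for n ≥ 5 the
factor is at most (5/3)³ < 5. -/
theorem kernelPrimitive_sub_nonneg_of_five_le (hθ : 0 < θ) (hθ' : θ < 1) {n : ℝ} (hn : 5 ≤ n) :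
    0 ≤ kernelPrimitive θ (1 / 2) (n - 2) (n - 1) n
      - kernelPrimitive θ (1 / 2) (n - 2) (n - 1) (n - 2) := by
  set x := n ^ (-(2 * θ) - 1) with hx
  have hx0 : 0 ≤ x := Real.rpow_nonneg (by linarith) _
  have hlow : (n - 2) ^ (-(2 * θ) - 1) ≤ 5 * x := by
    have h₁ : (n - 2) ^ (-(2 * θ) - 1) = (n / (n - 2)) ^ (2 * θ + 1) * x := by
      rw [hx, show -(2 * θ) - 1 = -(2 * θ + 1) by ring, Real.div_rpow (by linarith) (by linarith),
        Real.rpow_neg (by linarith), Real.rpow_neg (by linarith)]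
      have : 0 < n ^ (2 * θ + 1) := Real.rpow_pos_of_pos (by linarith) _
      have : 0 < (n - 2) ^ (2 * θ + 1) := Real.rpow_pos_of_pos (by linarith) _
      field_simp
    have h₂ : n / (n - 2) ≤ 5 / 3 := by rw [div_le_iff₀ (by linarith)]; linarith
    have h₃ : 1 ≤ n / (n - 2) := by rw [le_div_iff₀ (by linarith)]; linarith
    have h₄ : (n / (n - 2)) ^ (2 * θ + 1) ≤ 5 := by
      calc (n / (n - 2)) ^ (2 * θ + 1) ≤ (n / (n - 2)) ^ (3 : ℝ) :=
            Real.rpow_le_rpow_of_exponent_le h₃ (by linarith)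
        _ ≤ (5 / 3) ^ (3 : ℝ) := Real.rpow_le_rpow (by linarith) h₂ (by norm_num)
        _ ≤ 5 := by norm_num
    rw [h₁]
    gcongr
  have h₁ := sub_le_kernelPrimitive_sub hθ hθ' (1 / 2) (n - 2) (n - 1) (a := n - 2) (b := n - 1)
    (r := 5 * x) (by linarith) (by linarith)
    (fun t _ => hasDerivAt_cubic (1 / 2) (n - 2) (n - 1) t) fun t ht => by
      rw [mul_comm]
      refine mul_le_mul_of_nonpos_left ((Real.rpow_le_rpow_of_nonpos (by linarith) ht.1
        (by linarith)).trans hlow) ?_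
      exact mul_nonpos_of_nonneg_of_nonpos (by norm_num)
        (mul_nonpos_of_nonneg_of_nonpos (by linarith [ht.1]) (by linarith [ht.2]))
  have h₂ := sub_le_kernelPrimitive_sub hθ hθ' (1 / 2) (n - 2) (n - 1) (a := n - 1) (b := n)
    (r := x) (by linarith) (by linarith)
    (fun t _ => hasDerivAt_cubic (1 / 2) (n - 2) (n - 1) t) fun t ht => by
      rw [mul_comm]
      refine mul_le_mul_of_nonneg_left (Real.rpow_le_rpow_of_nonpos (by linarith [ht.1]) ht.2
        (by linarith)) ?_
      exact mul_nonneg (by norm_num) (mul_nonneg (by linarith [ht.1]) (by linarith [ht.1]))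
  ring_nf at h₁ h₂ ⊢
  linarith

/-- The numerical margin for the node 3 in the worst case θ → 1. The two sides are about 6.944 and
6.949, so a sharp bound for e is needed. -/
theorem le_five_mul_log_five_sub_log_three : 125 / 18 ≤ 5 * Real.log 5 - Real.log 3 := by
  have h : (125 : ℝ) ≤ Real.log ((5 ^ 5 / 3) ^ 18) := by
    rw [Real.le_log_iff_exp_le (by positivity)]
    calc Real.exp 125 = Real.exp 1 ^ 125 := by rw [← Real.exp_nat_mul]; norm_num
      _ ≤ 2.7182818286 ^ 125 := by gcongr; exact Real.exp_one_lt_d9.le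
      _ ≤ _ := by norm_num
  rw [Real.log_pow, Real.log_div (by norm_num) (by norm_num), Real.log_pow] at h
  push_cast at h
  linarith

/-- The factor-5 argument fails on [1, 3], so the cell [3, 5] must compensate. On [1, 3] write
t^(-2θ-1) = t^(2-2θ)/t³ and freeze the increasing numerator at the sign change 2. On [3, 5] write it
as t^(-2θ)/t and freeze the decreasing numerator at the sign change 4. -/
theorem kernelPrimitive_sub_nonneg_three (hθ : 0 < θ) (hθ' : θ < 1) :
    0 ≤ kernelPrimitive θ (1 / 2) 1 2 3 - kernelPrimitive θ (1 / 2) 1 2 1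
      + (kernelPrimitive θ (1 / 2) 4 5 5 - kernelPrimitive θ (1 / 2) 4 5 3) := by
  have hs₁ : ∀ t : ℝ, 0 < t → t ^ (-(2 * θ) - 1) = t ^ (2 - 2 * θ) / t ^ 3 := fun t ht => by
    rw [← Real.rpow_natCast, ← Real.rpow_sub ht]
    congr 1
    push_cast
    ring
  have hs₂ : ∀ t : ℝ, 0 < t → t ^ (-(2 * θ) - 1) = t ^ (-(2 * θ)) / t := fun t ht =>
    Real.rpow_sub_one ht.ne' _
  have h₁ := sub_le_kernelPrimitive_sub hθ hθ' (1 / 2) 1 2 (a := 1) (b := 3)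
    (r := 2 ^ (2 - 2 * θ)) one_pos (by norm_num)
    (P := fun t => 1 / 2 * (Real.log t + 3 * t⁻¹ - (t ^ 2)⁻¹))
    (p := fun t => 1 / 2 * ((t - 1) * (t - 2)) / t ^ 3) (fun t ht => ?_) (fun t ht => ?_)
  have h₂ := sub_le_kernelPrimitive_sub hθ hθ' (1 / 2) 4 5 (a := 3) (b := 5)
    (r := 4 ^ (-(2 * θ))) (by norm_num) (by norm_num)
    (P := fun t => 1 / 2 * (t ^ 2 / 2 - 9 * t + 20 * Real.log t))
    (p := fun t => 1 / 2 * ((t - 4) * (t - 5)) / t) (fun t ht => ?_) (fun t ht => ?_)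
  · refine le_trans ?_ (add_le_add h₁ h₂)
    have hc := fracLapConst_pos hθ hθ'
    -- Equality would hold at θ = 1; this removes θ and leaves the numerical inequality between
    -- logarithms.
    have hr : (2 : ℝ) ^ (2 - 2 * θ) / 16 ≤ 4 ^ (-(2 * θ)) := by
      rw [show (4 : ℝ) = 2 ^ (2 : ℝ) by norm_num, ← Real.rpow_mul zero_le_two,
        show (16 : ℝ) = 2 ^ (4 : ℝ) by norm_num, ← Real.rpow_sub zero_lt_two]
      exact Real.rpow_le_rpow_of_exponent_le one_le_two (by linarith)
    have hr0 : (0 : ℝ) < 2 ^ (2 - 2 * θ) := by positivity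
    have hlog := le_five_mul_log_five_sub_log_three
    have hlog' : 0 ≤ 20 * (Real.log 5 - Real.log 3) - 10 := by
      have : 1 ≤ Real.log ((5 / 3) ^ 2) := by
        rw [Real.le_log_iff_exp_le (by norm_num)]
        exact Real.exp_one_lt_d9.le.trans (by norm_num)
      rw [Real.log_pow, Real.log_div (by norm_num) (by norm_num)] at this
      push_cast at this
      linarith
    generalize (2 : ℝ) ^ (2 - 2 * θ) = x at *
    generalize (4 : ℝ) ^ (-(2 * θ)) = y at *
    have h₃ := mul_le_mul_of_nonneg_right hr hlog'
    have h₄ : 0 ≤ x * (Real.log 3 - 10 / 9) + y * (20 * (Real.log 5 - Real.log 3) - 10) := by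
      have := mul_le_mul_of_nonneg_left hlog hr0.le
      linarith
    have h₅ := mul_nonneg hc.le h₄
    norm_num
    linarith
  · have ht0 : 0 < t := by linarith [ht.1]
    refine ((((hasDerivAt_pow 2 t).div_const 2).fun_sub ((hasDerivAt_id' t).const_mul 9)).fun_add
      ((Real.hasDerivAt_log ht0.ne').const_mul 20)).const_mul (1 / 2) |>.congr_deriv ?_
    field_simp
    norm_num
    ring
  · have ht0 : 0 < t := by linarith [ht.1]
    rw [hs₂ t ht0, mul_comm, div_mul_eq_mul_div, mul_div_assoc']
    refine div_le_div_of_nonneg_right ?_ ht0.le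
    rcases le_total t 4 with h | h
    · refine mul_le_mul_of_nonneg_left (Real.rpow_le_rpow_of_nonpos ht0 h (by linarith)) ?_
      exact mul_nonneg (by norm_num)
        (mul_nonneg_of_nonpos_of_nonpos (by linarith) (by linarith [ht.2]))
    · refine mul_le_mul_of_nonpos_left
        (Real.rpow_le_rpow_of_nonpos (by norm_num) h (by linarith)) ?_
      exact mul_nonpos_of_nonneg_of_nonpos (by norm_num)
        (mul_nonpos_of_nonneg_of_nonpos (by linarith) (by linarith [ht.2]))
  · have ht0 : 0 < t := by linarith [ht.1]
    refine (((Real.hasDerivAt_log ht0.ne').fun_add ((hasDerivAt_inv ht0.ne').const_mul 3)).fun_sub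
      ((hasDerivAt_pow 2 t).fun_inv (by positivity))).const_mul (1 / 2) |>.congr_deriv ?_
    field_simp
    norm_num
    ring
  · have ht0 : 0 < t := by linarith [ht.1]
    rw [hs₁ t ht0, mul_comm, div_mul_eq_mul_div, mul_div_assoc']
    refine div_le_div_of_nonneg_right ?_ (by positivity)
    rcases le_total t 2 with h | h
    · refine mul_le_mul_of_nonpos_left (Real.rpow_le_rpow ht0.le h (by linarith)) ?_
      exact mul_nonpos_of_nonneg_of_nonpos (by norm_num)
        (mul_nonpos_of_nonneg_of_nonpos (by linarith [ht.1]) (by linarith))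
    · refine mul_le_mul_of_nonneg_left (Real.rpow_le_rpow zero_le_two h (by linarith)) ?_
      exact mul_nonneg (by norm_num) (mul_nonneg (by linarith) (by linarith))

theorem unitWeight_nonneg (hθ : 0 < θ) (hθ' : θ < 1) (n : ℕ) : 0 ≤ unitWeight θ n := by
  unfold unitWeight
  split_ifs with h0 h1 he
  · exact le_rfl
  · have e : deriv (deriv (auxG θ)) 1 = auxG₂ θ 1 := by
      have : deriv (auxG θ) =ᶠ[nhds 1] auxG₁ θ := by
        filter_upwards [lt_mem_nhds one_pos] with t ht
        exact deriv_auxG hθ' ht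
      rw [this.deriv_eq, (hasDerivAt_auxG₁ hθ one_pos).deriv]
    rw [e, deriv_auxG hθ' one_pos, deriv_auxG hθ' three_pos]
    -- The first weight is c/(2-2θ), the integral of t² c t^(-1-2θ) over [0, 1], plus the kernel
    -- integral over [1, 3].
    have h := kernelPrimitive_sub_nonneg hθ hθ' one_pos
    have hc : 0 ≤ fracLapConst θ / (2 - 2 * θ) :=
      div_nonneg (fracLapConst_pos hθ hθ').le (by linarith)
    norm_num [kernelPrimitive] at h
    linarith
  · have hn : (2 : ℝ) ≤ n := by
      have : 2 ≤ n := by omega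
      exact_mod_cast this
    rw [deriv_auxG hθ' (by linarith), deriv_auxG hθ' (by linarith)]
    -- At an even node the basis function is one parabola, vanishing at n ± 1 and nonnegative
    -- between.
    have h := sub_le_kernelPrimitive_sub hθ hθ' (-1) ((n : ℝ) - 1) (n + 1) (a := n - 1)
      (b := n + 1) (r := 0) (P := fun _ => 0) (p := fun _ => 0) (by linarith) (by linarith)
      (fun t _ => hasDerivAt_const t 0) fun t ht => by
        have : 0 < t := by linarith [ht.1]
        rw [mul_zero]
        refine mul_nonneg (mul_nonneg_of_nonpos_of_nonpos (by norm_num) ?_) (by positivity)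
        exact mul_nonpos_of_nonneg_of_nonpos (by linarith [ht.1]) (by linarith [ht.2])
    simp only [kernelPrimitive] at h
    ring_nf at h ⊢
    linarith
  · rw [Nat.not_even_iff_odd] at he
    obtain ⟨k, rfl⟩ := he
    have hn : (3 : ℝ) ≤ ((2 * k + 1 : ℕ) : ℝ) := by
      have : 3 ≤ 2 * k + 1 := by omega
      exact_mod_cast this
    set n : ℝ := ((2 * k + 1 : ℕ) : ℝ)
    rw [deriv_auxG hθ' (by linarith), deriv_auxG hθ' (by linarith), deriv_auxG hθ' (by linarith)]
    -- An odd node is shared by the cells [n-2, n] and [n, n+2]; on each, the kernel is the Lagrange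
    -- function equal to 1 at n.
    have h : 0 ≤ kernelPrimitive θ (1 / 2) (n - 2) (n - 1) n
        - kernelPrimitive θ (1 / 2) (n - 2) (n - 1) (n - 2)
        + (kernelPrimitive θ (1 / 2) (n + 1) (n + 2) (n + 2)
          - kernelPrimitive θ (1 / 2) (n + 1) (n + 2) n) := by
      rcases (show k = 1 ∨ 2 ≤ k by omega) with rfl | hk
      · have e : n = 3 := by simp [n]; norm_num
        have := kernelPrimitive_sub_nonneg_three hθ hθ'
        rw [e]
        norm_num at this ⊢
        exact this
      · have : 5 ≤ n := by
          have : 5 ≤ 2 * k + 1 := by omega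
          change (5 : ℝ) ≤ ((2 * k + 1 : ℕ) : ℝ)
          exact_mod_cast this
        exact add_nonneg (kernelPrimitive_sub_nonneg_of_five_le hθ hθ' this)
          (kernelPrimitive_sub_nonneg hθ hθ' (by linarith))
    simp only [kernelPrimitive] at h
    ring_nf at h ⊢
    linarith

theorem weight_nonneg (hθ : 0 < θ) (hθ' : θ < 1) {h : ℝ} (hh : 0 ≤ h) (j : ℤ) :
    0 ≤ weight θ h j :=
  mul_nonneg (Real.rpow_nonneg hh _) (unitWeight_nonneg hθ hθ' _)

end Positivity

/-! ### Reduction to a finite symmetric matrix -/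

/-- The matrix of the discrete fractional Laplacian. -/
def stiffness (θ h : ℝ) (i k : ℤ) : ℝ :=
  (if i = k then ∑' j, weight θ h j else 0) - weight θ h (i - k)

theorem stiffness_comm (θ h : ℝ) (i k : ℤ) : stiffness θ h i k = stiffness θ h k i := by
  unfold stiffness
  rw [← weight_neg θ h (i - k), neg_sub]
  simp only [eq_comm]

section FiniteSupport

variable {θ h : ℝ} {f : ℤ → ℝ} {S : Finset ℤ}

theorem summable_weight_mul_shift (hf : ∀ i ∉ S, f i = 0) (i : ℤ) :
    Summable fun j => weight θ h j * f (i - j) := by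
  refine summable_of_ne_finset_zero (s := S.image fun k => i - k) fun j hj => ?_
  rw [hf, mul_zero]
  exact fun hk => hj (Finset.mem_image.2 ⟨i - j, hk, by ring⟩)

/-- Jumps that leave S land on zeros of f, so they contribute only to the diagonal, which carries
the full sum of the weights. -/
theorem discFracLap_eq_sum (hw : Summable (weight θ h)) (hf : ∀ i ∉ S, f i = 0)
    {i : ℤ} (hi : i ∈ S) :
    discFracLap θ h f i = ∑ k ∈ S, stiffness θ h i k * f k := by
  have s := summable_weight_mul_shift (θ := θ) (h := h) hf i
  have e : ∑' j, weight θ h j * f (i - j) = ∑ k ∈ S, weight θ h (i - k) * f k := by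
    rw [← (Equiv.subLeft i).tsum_eq, tsum_eq_sum (s := S)]
    · simp
    · intro k hk
      simp [hf k hk]
  simp only [discFracLap, mul_sub]
  rw [(hw.mul_right (f i)).tsum_sub s, e, tsum_mul_right]
  simp [stiffness, sub_mul, Finset.sum_sub_distrib, hi]

/-- Reversal of a jump from `i` to `i - j`. -/
def reverseJump : ℤ × ℤ ≃ ℤ × ℤ :=
  Function.Involutive.toPerm (fun p => (p.1 - p.2, -p.2)) fun p => by simp

theorem reverseJump_apply (p : ℤ × ℤ) : reverseJump p = (p.1 - p.2, -p.2) := rfl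

theorem summable_sq_mul_weight (hw : Summable (weight θ h)) (hf : ∀ i ∉ S, f i = 0) :
    Summable fun p : ℤ × ℤ => f p.1 ^ 2 * weight θ h p.2 := by
  refine summable_mul_of_summable_norm (f := fun i => f i ^ 2) ?_ hw.norm
  exact summable_of_ne_finset_zero (s := S) fun i hi => by simp [hf i hi]

theorem summable_shift_sq_mul_weight (hw : Summable (weight θ h)) (hf : ∀ i ∉ S, f i = 0) :
    Summable fun p : ℤ × ℤ => f (p.1 - p.2) ^ 2 * weight θ h p.2 := by
  have := reverseJump.summable_iff.2 (summable_sq_mul_weight hw hf)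
  simpa [Function.comp_def, reverseJump_apply, weight_neg] using this

theorem tsum_shift_sq_mul_weight (θ h : ℝ) (f : ℤ → ℝ) :
    ∑' p : ℤ × ℤ, f (p.1 - p.2) ^ 2 * weight θ h p.2
      = ∑' p : ℤ × ℤ, f p.1 ^ 2 * weight θ h p.2 := by
  rw [← reverseJump.tsum_eq]
  simp [reverseJump_apply, weight_neg]

theorem summable_mul_shift_mul_weight (hw : Summable (weight θ h)) (hf : ∀ i ∉ S, f i = 0) :
    Summable fun p : ℤ × ℤ => f p.1 * f (p.1 - p.2) * weight θ h p.2 := by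
  refine Summable.of_norm_bounded
    ((summable_sq_mul_weight hw hf).norm.add (summable_shift_sq_mul_weight hw hf).norm) fun p => ?_
  simp only [norm_mul, norm_pow, Real.norm_eq_abs]
  rw [← add_mul]
  gcongr
  nlinarith [sq_nonneg (|f p.1| - |f (p.1 - p.2)|), sq_nonneg (|f p.1| + |f (p.1 - p.2)|)]

theorem mul_weight_mul_sq_sub (p : ℤ × ℤ) :
    h * weight θ h p.2 * |f p.1 - f (p.1 - p.2)| ^ 2
      = h * (f p.1 ^ 2 * weight θ h p.2 - 2 * (f p.1 * f (p.1 - p.2) * weight θ h p.2)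
        + f (p.1 - p.2) ^ 2 * weight θ h p.2) := by
  rw [sq_abs]; ring

theorem mem_spaceX_of_support {M : ℕ} (hw : Summable (weight θ h))
    (hf : ∀ i : ℤ, (M : ℤ) < |i| → f i = 0) : f ∈ spaceX θ h M := by
  refine ⟨hf, ?_⟩
  have hf' : ∀ i ∉ Finset.Icc (-(M : ℤ)) M, f i = 0 := fun i hi =>
    hf i (by rwa [Finset.mem_Icc, ← abs_le, not_le] at hi)
  simp only [mul_weight_mul_sq_sub]
  exact (((summable_sq_mul_weight hw hf').sub
    ((summable_mul_shift_mul_weight hw hf').mul_left 2)).add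
    (summable_shift_sq_mul_weight hw hf')).mul_left h

/-- Discrete integration by parts: after expanding the square, reversing the jumps identifies the
two square terms because the weights are even. -/
theorem half_tsum_eq_sum (hw : Summable (weight θ h)) (hf : ∀ i ∉ S, f i = 0) :
    1 / 2 * ∑' p : ℤ × ℤ, h * weight θ h p.2 * |f p.1 - f (p.1 - p.2)| ^ 2
      = h * ∑ i ∈ S, f i * discFracLap θ h f i := by
  have sA := summable_sq_mul_weight hw hf
  have sB := summable_mul_shift_mul_weight hw hf
  have sC := summable_shift_sq_mul_weight hw hf
  simp only [mul_weight_mul_sq_sub]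
  rw [tsum_mul_left, (sA.sub (sB.mul_left 2)).tsum_add sC, sA.tsum_sub (sB.mul_left 2),
    tsum_mul_left, tsum_shift_sq_mul_weight]
  have key : ∑' p : ℤ × ℤ, f p.1 ^ 2 * weight θ h p.2
      - ∑' p : ℤ × ℤ, f p.1 * f (p.1 - p.2) * weight θ h p.2
      = ∑ i ∈ S, f i * discFracLap θ h f i := by
    rw [← sA.tsum_sub sB, (sA.sub sB).tsum_prod, tsum_eq_sum (s := S)]
    · refine Finset.sum_congr rfl fun i _ => ?_
      rw [discFracLap, ← tsum_mul_left]
      exact tsum_congr fun j => by ring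
    · intro i hi
      simp [hf i hi]
  rw [← key]
  ring

theorem lqNorm_eq_sum {q : ℝ} (hq : 0 < q) (hf : ∀ i ∉ S, f i = 0) :
    lqNorm q h f = (∑ i ∈ S, h * |f i| ^ q) ^ (1 / q) := by
  rw [lqNorm, tsum_eq_sum (s := S)]
  intro i hi
  simp [hf i hi, hq.ne']

end FiniteSupport

/-- The grid points `i` with `|i| ≤ M`. -/
def grid (M : ℕ) : Finset ℤ := Finset.Icc (-(M : ℤ)) M

theorem mem_grid {M : ℕ} {i : ℤ} : i ∈ grid M ↔ |i| ≤ (M : ℤ) := by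
  rw [grid, Finset.mem_Icc, abs_le]

/-! ### Quadratic form and Rayleigh quotient on the grid -/

section Energy

variable {θ q h C : ℝ} {M : ℕ} {f : ℤ → ℝ}

theorem hSeminorm_eq_sqrt (hw : Summable (weight θ h)) (hf : ∀ i ∉ grid M, f i = 0) :
    hSeminorm θ h f = √(h * ∑ i ∈ grid M, f i * ∑ k ∈ grid M, stiffness θ h i k * f k) := by
  rw [hSeminorm, half_tsum_eq_sum hw hf]
  congr 2
  exact Finset.sum_congr rfl fun i hi => by rw [discFracLap_eq_sum hw hf hi]

theorem sum_rpow_pos_iff (hh : 0 < h) (hq : 0 < q) (hf : ∀ i ∉ grid M, f i = 0) :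
    0 < ∑ i ∈ grid M, h * |f i| ^ q ↔ f ≠ 0 := by
  constructor
  · rintro H rfl
    simp [hq.ne'] at H
  · intro H
    obtain ⟨i, hi⟩ := Function.ne_iff.1 H
    refine Finset.sum_pos' (fun j _ => by positivity) ⟨i, ?_, ?_⟩
    · by_contra hi'
      exact hi (hf i hi')
    · have : 0 < |f i| := abs_pos.2 hi
      positivity

theorem energy_nonneg (hw : Summable (weight θ h)) (hw₀ : ∀ j, 0 ≤ weight θ h j) (hh : 0 < h)
    (hf : ∀ i ∉ grid M, f i = 0) :
    0 ≤ h * ∑ i ∈ grid M, f i * ∑ k ∈ grid M, stiffness θ h i k * f k := by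
  have e : ∑ i ∈ grid M, f i * ∑ k ∈ grid M, stiffness θ h i k * f k
      = ∑ i ∈ grid M, f i * discFracLap θ h f i :=
    Finset.sum_congr rfl fun i hi => by rw [discFracLap_eq_sum hw hf hi]
  rw [e, ← half_tsum_eq_sum hw hf]
  exact mul_nonneg (by norm_num) (tsum_nonneg fun p =>
    mul_nonneg (mul_nonneg hh.le (hw₀ p.2)) (sq_nonneg _))

theorem quadForm_nonneg (hw : Summable (weight θ h)) (hw₀ : ∀ j, 0 ≤ weight θ h j) (hh : 0 < h)
    (f : ℤ → ℝ) :
    0 ≤ ∑ i ∈ grid M, f i * ∑ k ∈ grid M, stiffness θ h i k * f k := by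
  classical
  -- Only the values of f on the grid enter the form, so f may be truncated to have the required
  -- support.
  have := energy_nonneg (M := M) (f := fun i => if i ∈ grid M then f i else 0) hw hw₀ hh
    fun i hi => by simp [hi]
  have := nonneg_of_mul_nonneg_right this hh
  refine this.trans_eq (Finset.sum_congr rfl fun i hi => ?_)
  rw [if_pos hi]
  congr 1
  exact Finset.sum_congr rfl fun k hk => by rw [if_pos hk]

theorem hSeminorm_sq (hw : Summable (weight θ h)) (hw₀ : ∀ j, 0 ≤ weight θ h j) (hh : 0 < h)
    (hf : ∀ i ∉ grid M, f i = 0) :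
    hSeminorm θ h f ^ 2 = h * ∑ i ∈ grid M, f i * ∑ k ∈ grid M, stiffness θ h i k * f k := by
  rw [hSeminorm_eq_sqrt hw hf, Real.sq_sqrt (energy_nonneg hw hw₀ hh hf)]

theorem inv_sq_le_rayleigh (hw : Summable (weight θ h)) (hh : 0 < h) (hq : 0 < q) (hC : 0 < C)
    (hPS : IsPoincareSobolevConst θ q h M C) (hf : ∀ i ∉ grid M, f i = 0) (hf₀ : f ≠ 0) :
    C ^ (-2 : ℤ) ≤ rayleigh θ q h f := by
  have h₁ := hPS f (mem_spaceX_of_support hw fun i hi => hf i (by rw [mem_grid]; omega))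
  have h₂ : 0 < lqNorm q h f := by
    rw [lqNorm_eq_sum hq hf]
    exact Real.rpow_pos_of_pos ((sum_rpow_pos_iff hh hq hf).2 hf₀) _
  rw [rayleigh, zpow_neg, zpow_ofNat, le_div_iff₀ (by positivity), inv_mul_le_iff₀ (by positivity),
    ← mul_pow]
  exact pow_le_pow_left₀ h₂.le h₁ 2

end Energy

/-! ### Odd powers and their derivatives -/

section OddPow

variable {x p : ℝ}

theorem oddPow_zero_left (p : ℝ) : oddPow 0 p = 0 := by simp [oddPow]

theorem abs_oddPow (hp : p ≠ 0) (x : ℝ) : |oddPow x p| = |x| ^ p := by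
  rcases eq_or_ne x 0 with rfl | hx
  · simp [oddPow, hp]
  · have : 0 < |x| := abs_pos.2 hx
    rw [oddPow, abs_mul, abs_of_nonneg (by positivity), Real.rpow_sub_one this.ne',
      div_mul_cancel₀ _ this.ne']

theorem oddPow_oddPow_inv (hp : p ≠ 0) (x : ℝ) : oddPow (oddPow x p) (1 / p) = x := by
  rcases eq_or_ne x 0 with rfl | hx
  · simp [oddPow_zero_left]
  · have : 0 < |x| := abs_pos.2 hx
    rw [oddPow, abs_oddPow hp, oddPow, ← Real.rpow_mul this.le, ← mul_assoc, ← Real.rpow_add this,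
      show p * (1 / p - 1) + (p - 1) = 0 by field_simp; ring]
    simp

theorem oddPow_eq_sub (hp : 0 < p) (x : ℝ) : oddPow x p = max x 0 ^ p - max (-x) 0 ^ p := by
  rcases lt_trichotomy x 0 with hx | rfl | hx
  · rw [max_eq_right hx.le, max_eq_left (neg_nonneg.2 hx.le), Real.zero_rpow hp.ne', oddPow,
      abs_of_neg hx, Real.rpow_sub_one (by linarith), div_neg, neg_mul, div_mul_cancel₀ _ hx.ne,
      zero_sub]
  · simp [oddPow]
  · rw [max_eq_left hx.le, max_eq_right (neg_nonpos.2 hx.le), Real.zero_rpow hp.ne', oddPow,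
      abs_of_pos hx, Real.rpow_sub_one hx.ne']
    field_simp
    ring

theorem continuous_oddPow (hp : 0 < p) : Continuous fun x => oddPow x p := by
  simp only [oddPow_eq_sub hp]
  exact ((continuous_id.max continuous_const).rpow_const fun _ => Or.inr hp.le).sub
    ((continuous_neg.max continuous_const).rpow_const fun _ => Or.inr hp.le)

theorem hasDerivAt_oddPow (hp : 0 < p) (hx : x ≠ 0) :
    HasDerivAt (fun x => oddPow x p) (p * |x| ^ (p - 1)) x := by
  rcases lt_or_gt_of_ne hx with hx | hx
  · have e : (fun x => oddPow x p) =ᶠ[𝓝 x] fun x => -(-x) ^ p := by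
      filter_upwards [gt_mem_nhds hx] with y hy
      rw [oddPow_eq_sub hp, max_eq_right hy.le, max_eq_left (neg_nonneg.2 hy.le),
        Real.zero_rpow hp.ne', zero_sub]
    have := ((hasDerivAt_neg x).rpow_const (p := p) (Or.inl (neg_ne_zero.2 hx.ne))).fun_neg
    refine (this.congr_of_eventuallyEq e).congr_deriv ?_
    rw [abs_of_neg hx]
    ring
  · have e : (fun x => oddPow x p) =ᶠ[𝓝 x] fun x => x ^ p := by
      filter_upwards [lt_mem_nhds hx] with y hy
      rw [oddPow_eq_sub hp, max_eq_left hy.le, max_eq_right (neg_nonpos.2 hy.le),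
        Real.zero_rpow hp.ne', sub_zero]
    have := Real.hasDerivAt_rpow_const (p := p) (Or.inl hx.ne')
    refine (this.congr_of_eventuallyEq e).congr_deriv ?_
    rw [abs_of_pos hx]

/-- A function whose odd power has a derivative is itself differentiable where it is nonzero. -/
theorem hasDerivAt_of_oddPow {w : ℝ → ℝ} {t y' : ℝ} (hp : 0 < p)
    (h : HasDerivAt (fun s => oddPow (w s) p) y' t) (hw : w t ≠ 0) :
    HasDerivAt w (1 / p * |w t| ^ (1 - p) * y') t := by
  have hw' : 0 < |w t| := abs_pos.2 hw
  have hy : oddPow (w t) p ≠ 0 := by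
    rw [← abs_pos, abs_oddPow hp.ne']
    positivity
  have := (hasDerivAt_oddPow (one_div_pos.2 hp) hy).comp t h
  have e : (fun x => oddPow x (1 / p)) ∘ (fun s => oddPow (w s) p) = w := by
    funext s
    exact oddPow_oddPow_inv hp.ne' _
  rw [e] at this
  refine this.congr_deriv ?_
  rw [abs_oddPow hp.ne', ← Real.rpow_mul hw'.le]
  congr 3
  field_simp

/-- |w|^q is the power q/(q-1) > 1 of the modulus of the odd power, hence differentiable even at
zeros of w. -/
theorem hasDerivAt_abs_rpow_of_oddPow {w : ℝ → ℝ} {t y' q : ℝ} (hq : 1 < q)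
    (h : HasDerivAt (fun s => oddPow (w s) (q - 1)) y' t) :
    HasDerivAt (fun s => |w s| ^ q) (q / (q - 1) * w t * y') t := by
  have hp : 0 < q - 1 := by linarith
  have hr : 1 < q / (q - 1) := by rw [lt_div_iff₀ hp]; linarith
  have := (hasDerivAt_abs_rpow (oddPow (w t) (q - 1)) hr).comp t h
  have e : (fun x => |x| ^ (q / (q - 1))) ∘ (fun s => oddPow (w s) (q - 1))
      = fun s => |w s| ^ q := by
    funext s
    simp only [Function.comp]
    rw [abs_oddPow hp.ne', ← Real.rpow_mul (abs_nonneg _), mul_div_cancel₀ _ hp.ne']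
  rw [e] at this
  refine this.congr_deriv ?_
  have e' : q / (q - 1) - 2 = 1 / (q - 1) - 1 := by field_simp; ring
  have := oddPow_oddPow_inv hp.ne' (w t)
  rw [oddPow] at this
  rw [e', mul_assoc (q / (q - 1)), this]

end OddPow

/-- A continuous function whose upper left Dini derivative is nonpositive does not increase. -/
theorem le_of_left_dini_nonpos {f : ℝ → ℝ} {a b : ℝ} (hab : a ≤ b) (hf : ContinuousOn f (Icc a b))
    (H : ∀ t ∈ Ioc a b, ∃ (B : ℝ → ℝ) (c : ℝ), c ≤ 0 ∧ Tendsto B (𝓝[<] t) (𝓝 c) ∧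
      ∀ᶠ s in 𝓝[<] t, f t - f s ≤ (t - s) * B s) : f b ≤ f a := by
  -- Reflecting time turns left difference quotients into right ones.
  have key := image_le_of_liminf_slope_right_le_deriv_boundary (f := fun x => -f (-x))
    (a := -b) (b := -a) (B := fun _ => -f b) (B' := fun _ => 0) ?_ (by simp) continuousOn_const
    (fun x _ => hasDerivWithinAt_const _ _ _) ?_ (x := -a) ⟨by linarith, le_rfl⟩
  · simpa using key
  · exact (hf.comp continuousOn_neg fun x hx => ⟨by linarith [hx.2], by linarith [hx.1]⟩).neg
  · intro x hx r hr
    obtain ⟨B, c, hc, hB, hfB⟩ := H (-x) ⟨by linarith [hx.2], by linarith [hx.1]⟩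
    have hneg : Tendsto (fun z : ℝ => -z) (𝓝[>] x) (𝓝[<] (-x)) := tendsto_neg_nhdsGT
    refine Eventually.frequently ?_
    filter_upwards [hneg.eventually hfB, hneg.eventually (hB.eventually_lt_const (hc.trans_lt hr)),
      self_mem_nhdsWithin] with z h₁ h₂ h₃
    have hz : 0 < z - x := sub_pos.2 h₃
    rw [slope_def_field, div_lt_iff₀ hz]
    calc -f (-z) - -f (-x) = f (-x) - f (-z) := by ring
      _ ≤ (-x - -z) * B (-z) := h₁
      _ = B (-z) * (z - x) := by ring
      _ < r * (z - x) := by gcongr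

/-! ### Monotonicity of the Rayleigh quotient along the flow -/

section Flow

variable {ι : Type*} (S : Finset ι) (a : ι → ι → ℝ) (q h : ℝ)

/-- The action of the matrix `a` on vectors indexed by `S`. -/
def matVec (f : ι → ℝ) (i : ι) : ℝ := ∑ k ∈ S, a i k * f k

/-- The quadratic form of the matrix `a`, scaled by `h`. -/
def energy (f : ι → ℝ) : ℝ := h * ∑ i ∈ S, f i * matVec S a f i

/-- The weighted sum of `q`-th powers. -/
def mass (f : ι → ℝ) : ℝ := ∑ i ∈ S, h * |f i| ^ q

/-- The doubly nonlinear flow `(v ^ (q - 1))' = -a v`. -/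
structure IsFlow (v : ℝ → ι → ℝ) : Prop where
  continuousOn : ∀ i ∈ S, ContinuousOn (fun t => v t i) (Ici 0)
  hasDerivAt : ∀ i ∈ S, ∀ t : ℝ, 0 < t →
    HasDerivAt (fun s => oddPow (v s i) (q - 1)) (-matVec S a (v t) i) t

variable {S a q h} {v : ℝ → ι → ℝ}

theorem mass_nonneg (hh : 0 ≤ h) (f : ι → ℝ) : 0 ≤ mass S q h f :=
  Finset.sum_nonneg fun _ _ => by positivity

theorem IsFlow.hasDerivAt_mass (hv : IsFlow S a q v) (hq : 1 < q) {t : ℝ} (ht : 0 < t) :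
    HasDerivAt (fun s => mass S q h (v s)) (-(q / (q - 1)) * energy S a h (v t)) t := by
  have := HasDerivAt.fun_sum fun i (hi : i ∈ S) =>
    (hasDerivAt_abs_rpow_of_oddPow hq (hv.hasDerivAt i hi t ht)).const_mul h
  refine this.congr_deriv ?_
  rw [energy, Finset.mul_sum, Finset.mul_sum]
  exact Finset.sum_congr rfl fun i _ => by ring

theorem IsFlow.continuousOn_mass (hv : IsFlow S a q v) (hq : 0 ≤ q) :
    ContinuousOn (fun s => mass S q h (v s)) (Ici 0) :=
  continuousOn_finsetSum _ fun i hi =>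
    continuousOn_const.mul ((hv.continuousOn i hi).abs.rpow_const fun _ _ => Or.inr hq)

theorem IsFlow.continuousOn_energy (hv : IsFlow S a q v) :
    ContinuousOn (fun s => energy S a h (v s)) (Ici 0) :=
  continuousOn_const.mul <| continuousOn_finsetSum _ fun i hi => (hv.continuousOn i hi).mul <|
    continuousOn_finsetSum _ fun k hk => continuousOn_const.mul (hv.continuousOn k hk)

/-- By symmetry the two sides differ exactly by the energy of f - g, which is nonnegative. -/
theorem energy_sub_le (hh : 0 ≤ h) (ha : ∀ i k, a i k = a k i)
    (hpos : ∀ f : ι → ℝ, 0 ≤ ∑ i ∈ S, f i * matVec S a f i) (f g : ι → ℝ) :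
    energy S a h f - energy S a h g ≤ 2 * h * ∑ i ∈ S, matVec S a f i * (f i - g i) := by
  have hsymm : ∑ i ∈ S, f i * matVec S a g i = ∑ i ∈ S, g i * matVec S a f i := by
    simp only [matVec, Finset.mul_sum]
    rw [Finset.sum_comm]
    exact Finset.sum_congr rfl fun i _ => Finset.sum_congr rfl fun k _ => by rw [ha i k]; ring
  have hsub : ∀ i, matVec S a (f - g) i = matVec S a f i - matVec S a g i := fun i => by
    simp only [matVec, ← Finset.sum_sub_distrib]
    exact Finset.sum_congr rfl fun k _ => by simp; ring
  have H : ∑ i ∈ S, (f - g) i * matVec S a (f - g) i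
      = ∑ i ∈ S, f i * matVec S a f i - ∑ i ∈ S, f i * matVec S a g i
        - ∑ i ∈ S, g i * matVec S a f i + ∑ i ∈ S, g i * matVec S a g i := by
    simp only [← Finset.sum_sub_distrib, ← Finset.sum_add_distrib]
    exact Finset.sum_congr rfl fun i _ => by rw [hsub]; simp; ring
  have H' : ∑ i ∈ S, matVec S a f i * (f i - g i)
      = ∑ i ∈ S, f i * matVec S a f i - ∑ i ∈ S, g i * matVec S a f i := by
    simp only [← Finset.sum_sub_distrib]
    exact Finset.sum_congr rfl fun i _ => by ring
  have := mul_nonneg hh (hpos (f - g))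
  rw [H, hsymm] at this
  rw [energy, energy, H']
  linarith

/-- The one-sided bound for the variation of a component of the flow, tested with its velocity. -/
theorem exists_left_bound {w : ℝ → ℝ} {t l : ℝ} (hq : 1 < q)
    (hw : HasDerivAt (fun s => oddPow (w s) (q - 1)) (-l) t) :
    ∃ B : ℝ → ℝ, Tendsto B (𝓝[<] t)
        (𝓝 (-(1 / (q - 1)) * if w t = 0 then 0 else |w t| ^ (2 - q) * l ^ 2)) ∧
      ∀ᶠ s in 𝓝[<] t, l * (w t - w s) ≤ (t - s) * B s := by
  have hp : 0 < q - 1 := by linarith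
  have hle : 𝓝[<] t ≤ 𝓝[≠] t := nhdsWithin_mono t fun x (hx : x < t) => hx.ne
  by_cases h0 : w t = 0
  · refine ⟨fun _ => 0, by simp [h0], ?_⟩
    simp only [h0, mul_zero, zero_sub]
    rcases eq_or_ne l 0 with rfl | hl
    · simp
    -- The odd power vanishes at t with slope -l, so just before t it has the sign of l; hence l * w
    -- s > 0 and the left side is negative.
    have hs := ((hasDerivAt_iff_tendsto_slope.1 hw).mono_left hle).const_mul l
    filter_upwards [hs.eventually_lt_const (show l * -l < 0 by nlinarith [sq_pos_of_ne_zero hl]),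
      self_mem_nhdsWithin] with s h₁ (h₂ : s < t)
    rw [slope_def_field, h0, oddPow_zero_left, sub_zero, ← mul_div_assoc, oddPow] at h₁
    have h₃ : 0 < |w s| ^ (q - 1 - 1) * (l * w s) := by
      by_contra! hc
      exact absurd (div_nonneg_of_nonpos (b := s - t) hc (by linarith))
        (by rw [not_le]; convert h₁ using 2; ring)
    have h₄ := pos_of_mul_pos_right h₃ (by positivity)
    linarith
  · have hd := hasDerivAt_of_oddPow hp hw h0
    refine ⟨fun s => l * slope w t s, ?_, ?_⟩
    · convert ((hasDerivAt_iff_tendsto_slope.1 hd).mono_left hle).const_mul l using 2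
      rw [if_neg h0, show 1 - (q - 1) = 2 - q by ring]
      ring
    · filter_upwards [self_mem_nhdsWithin] with s (hs : s < t)
      rw [slope_def_field]
      have : s - t ≠ 0 := by linarith
      refine le_of_eq ?_
      field_simp
      ring

/-- Cauchy–Schwarz after splitting |f_i| = |f_i|^(q/2) |f_i|^((2-q)/2). The zero components are
excluded since |f_i|^(2-q) is singular there when q > 2. -/
theorem energy_sq_le (hh : 0 ≤ h) (f : ι → ℝ) :
    energy S a h f ^ 2 ≤ mass S q h f *
      (h * ∑ i ∈ S, if f i = 0 then 0 else |f i| ^ (2 - q) * matVec S a f i ^ 2) := by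
  rw [energy, mass, Finset.mul_sum, Finset.mul_sum]
  refine Finset.sum_sq_le_sum_mul_sum_of_sq_le_mul S (fun i _ => by positivity)
    (fun i _ => by split_ifs <;> positivity) fun i _ => le_of_eq ?_
  split_ifs with h0
  · simp [h0]
  · have : 0 < |f i| := abs_pos.2 h0
    have e : |f i| ^ q * |f i| ^ (2 - q) = f i ^ 2 := by
      rw [← Real.rpow_add this, ← sq_abs, ← Real.rpow_natCast]
      congr 1
      push_cast
      ring
    calc (h * (f i * matVec S a f i)) ^ 2 = h ^ 2 * f i ^ 2 * matVec S a f i ^ 2 := by ring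
      _ = _ := by rw [← e]; ring

theorem IsFlow.exists_left_bound_energy (hv : IsFlow S a q v) (hq : 1 < q) (hh : 0 ≤ h)
    (ha : ∀ i k, a i k = a k i) (hpos : ∀ f : ι → ℝ, 0 ≤ ∑ i ∈ S, f i * matVec S a f i)
    {t : ℝ} (ht : 0 < t) :
    ∃ (B : ℝ → ℝ) (b : ℝ), Tendsto B (𝓝[<] t) (𝓝 b) ∧
      (∀ᶠ s in 𝓝[<] t, energy S a h (v t) - energy S a h (v s) ≤ (t - s) * B s) ∧
      b * mass S q h (v t) ≤ -(2 / (q - 1)) * energy S a h (v t) ^ 2 := by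
  have hp : 0 < q - 1 := by linarith
  have hex : ∀ i : ι, ∃ B : ℝ → ℝ, i ∈ S → Tendsto B (𝓝[<] t)
        (𝓝 (-(1 / (q - 1)) * if v t i = 0 then 0 else
          |v t i| ^ (2 - q) * matVec S a (v t) i ^ 2)) ∧
      ∀ᶠ s in 𝓝[<] t, matVec S a (v t) i * (v t i - v s i) ≤ (t - s) * B s := fun i => by
    by_cases hi : i ∈ S
    · obtain ⟨B, hB⟩ := exists_left_bound hq (hv.hasDerivAt i hi t ht)
      exact ⟨B, fun _ => hB⟩
    · exact ⟨fun _ => 0, fun h => absurd h hi⟩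
  choose B hB using hex
  refine ⟨fun s => 2 * h * ∑ i ∈ S, B i s, _,
    (tendsto_finsetSum S fun i hi => (hB i hi).1).const_mul (2 * h), ?_, ?_⟩
  · have : ∀ᶠ s in 𝓝[<] t, ∀ i ∈ S,
        matVec S a (v t) i * (v t i - v s i) ≤ (t - s) * B i s :=
      (Filter.eventually_all_finset S).2 fun i hi => (hB i hi).2
    filter_upwards [this] with s hs
    refine (energy_sub_le hh ha hpos (v t) (v s)).trans ?_
    calc _ ≤ 2 * h * ∑ i ∈ S, (t - s) * B i s := by
          exact mul_le_mul_of_nonneg_left (Finset.sum_le_sum hs) (by positivity)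
      _ = _ := by rw [← Finset.mul_sum]; ring
  · have := energy_sq_le (S := S) (a := a) (q := q) hh (v t)
    rw [← Finset.mul_sum]
    have h2 : 0 ≤ 2 / (q - 1) := by positivity
    have h3 := mul_le_mul_of_nonneg_left this h2
    calc _ = -(2 / (q - 1) * (mass S q h (v t) * (h * ∑ i ∈ S, if v t i = 0 then 0 else
          |v t i| ^ (2 - q) * matVec S a (v t) i ^ 2))) := by ring
      _ ≤ _ := by linarith

/-- The Rayleigh quotient does not increase along the flow. -/
theorem IsFlow.antitoneOn_quotient (hv : IsFlow S a q v) (hq : 1 < q) (hh : 0 ≤ h)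
    (ha : ∀ i k, a i k = a k i) (hpos : ∀ f : ι → ℝ, 0 ≤ ∑ i ∈ S, f i * matVec S a f i)
    {T : ℝ} (hT : ∀ t ∈ Icc 0 T, 0 < mass S q h (v t)) :
    AntitoneOn (fun t => energy S a h (v t) * mass S q h (v t) ^ (-(2 / q))) (Icc 0 T) := by
  intro t₁ h₁ t₂ h₂ h₁₂
  have hsub : Icc t₁ t₂ ⊆ Icc 0 T := Icc_subset_Icc h₁.1 h₂.2
  have hsub' : Icc t₁ t₂ ⊆ Ici 0 := fun x hx => (hsub hx).1
  refine le_of_left_dini_nonpos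
    (f := fun t => energy S a h (v t) * mass S q h (v t) ^ (-(2 / q))) h₁₂ ?_ fun t ht => ?_
  · exact (hv.continuousOn_energy.mono hsub').mul
      (((hv.continuousOn_mass (by linarith)).mono hsub').rpow_const
        fun x hx => Or.inl (hT x (hsub hx)).ne')
  have ht₀ : 0 < t := h₁.1.trans_lt ht.1
  have hN := hT t (hsub ⟨ht.1.le, ht.2⟩)
  obtain ⟨B, b, hB, hEB, hb⟩ := hv.exists_left_bound_energy hq hh ha hpos ht₀
  have hd := (hv.hasDerivAt_mass (h := h) hq ht₀).rpow_const (p := -(2 / q)) (Or.inl hN.ne')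
  have hle : 𝓝[<] t ≤ 𝓝[≠] t := nhdsWithin_mono t fun x (hx : x < t) => hx.ne
  have hc := hd.continuousAt.tendsto.mono_left (nhdsWithin_le_nhds (s := Iio t))
  have hs := (hasDerivAt_iff_tendsto_slope.1 hd).mono_left hle
  -- Leibniz rule for difference quotients: the power of the mass is taken at s in one term and the
  -- energy at t in the other, so the one-sided energy bound is multiplied by a nonnegative factor.
  refine ⟨_, _, ?_, (hB.mul hc).add (hs.const_mul (energy S a h (v t))), ?_⟩
  · have hq0 : q ≠ 0 := by linarith
    have hp : q - 1 ≠ 0 := by linarith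
    rw [Real.rpow_sub_one hN.ne']
    set N := mass S q h (v t)
    set E := energy S a h (v t)
    have : b * N ^ (-(2 / q)) + E * (-(q / (q - 1)) * E * -(2 / q) * (N ^ (-(2 / q)) / N))
        = N ^ (-(2 / q)) / N * (b * N + 2 / (q - 1) * E ^ 2) := by
      field_simp
    rw [this]
    exact mul_nonpos_of_nonneg_of_nonpos (by positivity) (by linarith)
  · filter_upwards [hEB, self_mem_nhdsWithin] with s h₃ (h₄ : s < t)
    rw [slope_def_field]
    have : s - t ≠ 0 := by linarith
    have hm : 0 ≤ mass S q h (v s) ^ (-(2 / q)) := Real.rpow_nonneg (mass_nonneg hh _) _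
    have := mul_le_mul_of_nonneg_right h₃ hm
    set x := mass S q h (v t) ^ (-(2 / q))
    set y := mass S q h (v s) ^ (-(2 / q))
    have e : (t - s) * ((y - x) / (s - t)) = x - y := by field_simp; ring
    calc _ = (energy S a h (v t) - energy S a h (v s)) * y + energy S a h (v t) * (x - y) := by
          ring
      _ ≤ (t - s) * B s * y + energy S a h (v t) * ((t - s) * ((y - x) / (s - t))) := by
          rw [e]; gcongr
      _ = _ := by ring

end Flow

/-! ### Scalar decay and extinction -/

/-- The properties of the mass `N` and of the Rayleigh quotient `R` along the flow which determine
the decay of `N`. -/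
structure IsDecay (q l₀ l₁ : ℝ) (N R : ℝ → ℝ) : Prop where
  one_lt : 1 < q
  lower_pos : 0 < l₁
  continuousOn : ContinuousOn N (Ici 0)
  pos_zero : 0 < N 0
  nonneg : ∀ t, 0 ≤ t → 0 ≤ N t
  hasDerivAt : ∀ t, 0 < t → HasDerivAt N (-(q / (q - 1)) * (R t * N t ^ (2 / q))) t
  le_upper : ∀ t, 0 ≤ t → (∀ s ∈ Icc 0 t, 0 < N s) → R t ≤ l₀
  lower_le : ∀ t, 0 ≤ t → 0 < N t → l₁ ≤ R t

namespace IsDecay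

variable {q l₀ l₁ : ℝ} {N R : ℝ → ℝ}

theorem antitoneOn (H : IsDecay q l₀ l₁ N R) : AntitoneOn N (Ici 0) := by
  have hq := H.one_lt
  refine antitoneOn_of_deriv_nonpos (convex_Ici 0) H.continuousOn ?_ ?_
  · rw [interior_Ici]
    exact fun t ht => (H.hasDerivAt t ht).differentiableAt.differentiableWithinAt
  · rw [interior_Ici]
    intro t (ht : 0 < t)
    rw [(H.hasDerivAt t ht).deriv]
    have h1 : 0 ≤ q / (q - 1) := div_nonneg (by linarith) (by linarith)
    rcases (H.nonneg t ht.le).eq_or_lt with h0 | h0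
    · rw [← h0, Real.zero_rpow (div_ne_zero two_ne_zero (by linarith))]
      simp
    · have := H.lower_pos.le.trans (H.lower_le t ht.le h0)
      have : 0 ≤ q / (q - 1) * (R t * N t ^ (2 / q)) := by positivity
      linarith

theorem le_upper_of_pos (H : IsDecay q l₀ l₁ N R) {t : ℝ} (ht : 0 ≤ t) (h : 0 < N t) :
    R t ≤ l₀ :=
  H.le_upper t ht fun _ hs => h.trans_le (H.antitoneOn hs.1 ht hs.2)

/-- The power (q-2)/q linearises the equation, and r is R at a mean-value point. When q > 2 this
power is continuous at 0, so t may be the extinction time itself. -/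
theorem exists_mean (H : IsDecay q l₀ l₁ N R) {s t : ℝ} (hs : 0 ≤ s) (hst : s < t)
    (hpos : ∀ τ ∈ Ico s t, 0 < N τ) (ht : 0 < N t ∨ 2 < q) :
    ∃ r, l₁ ≤ r ∧ r ≤ l₀ ∧
      N t ^ ((q - 2) / q) = N s ^ ((q - 2) / q) - (q - 2) / (q - 1) * r * (t - s) := by
  have hq := H.one_lt
  have hq0 : 0 < q := by linarith
  have hc : ContinuousOn (fun τ => N τ ^ ((q - 2) / q)) (Icc s t) := by
    refine (H.continuousOn.mono fun τ hτ => hs.trans hτ.1).rpow_const fun τ hτ => ?_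
    rcases hτ.2.eq_or_lt with rfl | hlt
    · exact ht.imp (fun h => h.ne') fun h => div_nonneg (by linarith) hq0.le
    · exact Or.inl (hpos τ ⟨hτ.1, hlt⟩).ne'
  obtain ⟨c, hcm, hcs⟩ := exists_hasDerivAt_eq_slope _ _ hst hc fun τ hτ =>
    (H.hasDerivAt τ (hs.trans_lt hτ.1)).rpow_const (p := (q - 2) / q)
      (Or.inl (hpos τ ⟨hτ.1.le, hτ.2⟩).ne')
  have hNc := hpos c ⟨hcm.1.le, hcm.2⟩
  have hc0 : 0 ≤ c := hs.trans hcm.1.le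
  refine ⟨R c, H.lower_le c hc0 hNc, H.le_upper_of_pos hc0 hNc, ?_⟩
  have e : N c ^ (2 / q) * N c ^ ((q - 2) / q - 1) = 1 := by
    rw [← Real.rpow_add hNc, show 2 / q + ((q - 2) / q - 1) = 0 by field_simp; ring,
      Real.rpow_zero]
  have hp : q - 1 ≠ 0 := by linarith
  have e' : -(q / (q - 1)) * (R c * N c ^ (2 / q)) * ((q - 2) / q) * N c ^ ((q - 2) / q - 1)
      = -((q - 2) / (q - 1) * R c) := by
    calc _ = -(q / (q - 1)) * ((q - 2) / q) * R c
          * (N c ^ (2 / q) * N c ^ ((q - 2) / q - 1)) := by ring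
      _ = _ := by rw [e]; field_simp
  rw [e', eq_div_iff (by linarith)] at hcs
  linarith

theorem exists_first_zero (H : IsDecay q l₀ l₁ N R) (hz : ∃ t, 0 ≤ t ∧ N t = 0) :
    ∃ T, 0 < T ∧ ∀ t, 0 ≤ t → (N t = 0 ↔ T ≤ t) := by
  set Z : Set ℝ := Ici 0 ∩ N ⁻¹' {0} with hZ
  have hcl : IsClosed Z := H.continuousOn.preimage_isClosed_of_isClosed isClosed_Ici
    isClosed_singleton
  have hbd : BddBelow Z := ⟨0, fun t ht => ht.1⟩
  have hmem : sInf Z ∈ Z := hcl.csInf_mem hz hbd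
  refine ⟨sInf Z, ?_, fun t ht => ⟨fun h => csInf_le hbd ⟨ht, h⟩, fun h => ?_⟩⟩
  · refine lt_of_le_of_ne hmem.1 fun h => ?_
    have := hmem.2
    rw [← h] at this
    exact H.pos_zero.ne' this
  · exact le_antisymm ((H.antitoneOn hmem.1 ht h).trans_eq hmem.2) (H.nonneg t ht)

/-- For q ≤ 2 the exponent 2/q is at least 1, so N' ≥ -K N before a first zero; then N e^(Ks) is
nondecreasing and cannot reach 0. -/
theorem pos_of_le_two (H : IsDecay q l₀ l₁ N R) (hq2 : q ≤ 2) {t : ℝ} (ht : 0 ≤ t) :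
    0 < N t := by
  by_contra hN
  obtain ⟨T, hT, hTz⟩ := H.exists_first_zero
    ⟨t, ht, le_antisymm (not_lt.1 hN) (H.nonneg t ht)⟩
  have hq := H.one_lt
  have hq0 : 0 < q := by linarith
  have hpos : ∀ s, 0 ≤ s → s < T → 0 < N s := fun s hs hsT =>
    lt_of_le_of_ne (H.nonneg s hs) fun h => not_le.2 hsT ((hTz s hs).1 h.symm)
  set K := q / (q - 1) * (l₀ * N 0 ^ (2 / q - 1)) with hK
  have hd : ∀ s, 0 < s → HasDerivAt (fun s => N s * Real.exp (K * s))
      (-(q / (q - 1)) * (R s * N s ^ (2 / q)) * Real.exp (K * s)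
        + N s * (Real.exp (K * s) * K)) s := fun s hs =>
    (H.hasDerivAt s hs).fun_mul (((hasDerivAt_id' s).const_mul K).exp.congr_deriv (by ring))
  have hmono : MonotoneOn (fun s => N s * Real.exp (K * s)) (Icc 0 T) := by
    refine monotoneOn_of_deriv_nonneg (convex_Icc 0 T)
      ((H.continuousOn.mono fun s hs => hs.1).mul (by fun_prop)) ?_ ?_
    · rw [interior_Icc]
      exact fun s hs => (hd s hs.1).differentiableAt.differentiableWithinAt
    · rw [interior_Icc]
      intro s hs
      rw [(hd s hs.1).deriv]
      have hNs := hpos s hs.1.le hs.2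
      have h₁ : R s * N s ^ (2 / q) ≤ l₀ * (N 0 ^ (2 / q - 1) * N s) := by
        have e : N s ^ (2 / q) = N s ^ (2 / q - 1) * N s := by
          rw [Real.rpow_sub_one hNs.ne', div_mul_cancel₀ _ hNs.ne']
        have h0 := H.lower_pos.le.trans (H.lower_le s hs.1.le hNs)
        have h1 := H.le_upper_of_pos hs.1.le hNs
        have h2 := H.antitoneOn (mem_Ici.2 le_rfl) hs.1.le hs.1.le
        have h3 : 0 ≤ 2 / q - 1 := by rw [sub_nonneg, le_div_iff₀ hq0]; linarith
        rw [e]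
        have h4 := Real.rpow_le_rpow hNs.le h2 h3
        have h5 := h0.trans h1
        gcongr
      have h₂ : 0 ≤ q / (q - 1) := div_nonneg hq0.le (by linarith)
      have h₃ := mul_le_mul_of_nonneg_left h₁ h₂
      have h₄ := mul_nonneg (Real.exp_pos (K * s)).le (sub_nonneg.2 h₃)
      rw [hK] at h₄ ⊢
      linarith
  have := hmono ⟨le_rfl, hT.le⟩ ⟨hT.le, le_rfl⟩ hT.le
  simp only [(hTz T hT.le).2 le_rfl, mul_zero, Real.exp_zero, mul_one, zero_mul] at this
  exact absurd H.pos_zero this.not_gt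

theorem exists_extinction (H : IsDecay q l₀ l₁ N R) (hq2 : 2 < q) :
    ∃ T, 0 < T ∧ ∀ t, 0 ≤ t → (N t = 0 ↔ T ≤ t) := by
  refine H.exists_first_zero ?_
  by_contra! hne
  have hpos : ∀ t, 0 ≤ t → 0 < N t := fun t ht => lt_of_le_of_ne (H.nonneg t ht) (hne t ht).symm
  set P := N 0 ^ ((q - 2) / q)
  set k := (q - 2) / (q - 1) with hk
  have hk0 : 0 < k := div_pos (by linarith) (by linarith)
  have hkl : 0 < k * l₁ := mul_pos hk0 H.lower_pos
  have hP : 0 < P := Real.rpow_pos_of_pos H.pos_zero _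
  -- At this time the upper bound P - k l₁ t reaches 0.
  have ht : 0 < P / (k * l₁) := div_pos hP hkl
  obtain ⟨r, hr, -, e⟩ := H.exists_mean le_rfl ht (fun τ hτ => hpos τ hτ.1) (Or.inr hq2)
  have h₁ := Real.rpow_pos_of_pos (hpos _ ht.le) ((q - 2) / q)
  rw [e, sub_zero] at h₁
  have h₂ : k * l₁ * (P / (k * l₁)) ≤ k * r * (P / (k * l₁)) := by gcongr
  rw [mul_div_cancel₀ _ hkl.ne'] at h₂
  linarith

theorem rpow_rpow_eq (hq : 0 < q) (hq2 : q ≠ 2) {x : ℝ} (hx : 0 ≤ x) :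
    (x ^ ((q - 2) / q)) ^ (1 / (q - 2)) = x ^ (1 / q) := by
  have : q - 2 ≠ 0 := sub_ne_zero.2 hq2
  rw [← Real.rpow_mul hx]
  congr 1
  field_simp

/-- The extinction profile. -/
theorem extinction_bounds (H : IsDecay q l₀ l₁ N R) (hq2 : 2 < q) {T : ℝ} (hT : 0 < T)
    (hTz : ∀ t, 0 ≤ t → (N t = 0 ↔ T ≤ t)) {t : ℝ} (ht : 0 ≤ t) :
    (max ((q - 2) / (q - 1) * l₁ * (T - t)) 0) ^ (1 / (q - 2)) ≤ N t ^ (1 / q) ∧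
      N t ^ (1 / q) ≤ (max ((q - 2) / (q - 1) * l₀ * (T - t)) 0) ^ (1 / (q - 2)) := by
  have hq0 : 0 < q := by linarith
  have he : 0 < 1 / (q - 2) := one_div_pos.2 (by linarith)
  have hk : 0 < (q - 2) / (q - 1) := div_pos (by linarith) (by linarith)
  have hl₁ := H.lower_pos
  have hl : l₁ ≤ l₀ := (H.lower_le 0 le_rfl H.pos_zero).trans (H.le_upper_of_pos le_rfl H.pos_zero)
  have hl₀ : 0 < l₀ := hl₁.trans_le hl
  rcases le_or_gt T t with h | h
  · rw [(hTz t ht).2 h, max_eq_right, max_eq_right, Real.zero_rpow he.ne',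
      Real.zero_rpow (one_div_pos.2 hq0).ne']
    · simp
    · exact mul_nonpos_of_nonneg_of_nonpos (by positivity) (by linarith)
    · exact mul_nonpos_of_nonneg_of_nonpos (by positivity) (by linarith)
  · obtain ⟨r, hr₁, hr₀, e⟩ := H.exists_mean ht h (fun τ hτ =>
      lt_of_le_of_ne (H.nonneg τ (ht.trans hτ.1)) fun h' =>
        not_le.2 hτ.2 ((hTz τ (ht.trans hτ.1)).1 h'.symm)) (Or.inr hq2)
    rw [(hTz T hT.le).2 le_rfl,
      Real.zero_rpow (div_pos (by linarith) hq0).ne', eq_comm, sub_eq_zero] at e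
    have hTt : 0 < T - t := sub_pos.2 h
    rw [← rpow_rpow_eq hq0 hq2.ne' (H.nonneg t ht), e, max_eq_left (by positivity),
      max_eq_left (by positivity)]
    have : 0 < r := hl₁.trans_le hr₁
    constructor <;> gcongr

/-- The two-sided decay estimate. -/
theorem decay_bounds (H : IsDecay q l₀ l₁ N R) (hq2 : q ≠ 2) {t : ℝ} (ht : 0 < t) :
    (max (N 0 ^ ((q - 2) / q) + (2 - q) / (q - 1) * l₀ * t) 0) ^ (-1 / (2 - q)) ≤ N t ^ (1 / q) ∧
      N t ^ (1 / q) ≤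
        (max (N 0 ^ ((q - 2) / q) + (2 - q) / (q - 1) * l₁ * t) 0) ^ (-1 / (2 - q)) := by
  have hq := H.one_lt
  have hq0 : 0 < q := by linarith
  have ee : -1 / (2 - q) = 1 / (q - 2) := by
    rw [← neg_sub q 2, neg_div_neg_eq]
  have ek : (2 - q) / (q - 1) = -((q - 2) / (q - 1)) := by
    rw [← neg_sub q 2, neg_div]
  have hl₁ := H.lower_pos
  have hl : l₁ ≤ l₀ := (H.lower_le 0 le_rfl H.pos_zero).trans (H.le_upper_of_pos le_rfl H.pos_zero)
  have hP := Real.rpow_pos_of_pos H.pos_zero ((q - 2) / q)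
  rw [ee, ← rpow_rpow_eq hq0 hq2 (H.nonneg t ht.le)]
  rcases lt_or_gt_of_ne hq2 with hq2 | hq2
  · have hpos : ∀ s, 0 ≤ s → 0 < N s := fun s hs => H.pos_of_le_two hq2.le hs
    obtain ⟨r, hr₁, hr₀, e⟩ := H.exists_mean le_rfl ht (fun τ hτ => hpos τ hτ.1)
      (Or.inl (hpos t ht.le))
    have hk : 0 < (2 - q) / (q - 1) := div_pos (by linarith) (by linarith)
    have he : 1 / (q - 2) ≤ 0 := one_div_nonpos.2 (by linarith)
    have e' : N t ^ ((q - 2) / q) = N 0 ^ ((q - 2) / q) + (2 - q) / (q - 1) * r * t := by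
      rw [e, ek]; ring
    have hr : 0 < r := hl₁.trans_le hr₁
    have hl₀ : 0 < l₀ := hl₁.trans_le hl
    rw [e', max_eq_left (by positivity), max_eq_left (by positivity)]
    -- The outer exponent is negative, so the larger rate l₀ gives the lower bound.
    constructor <;> refine Real.rpow_le_rpow_of_nonpos (by positivity) ?_ he <;> gcongr
  · obtain ⟨T, hT, hTz⟩ := H.exists_extinction hq2
    have hk : 0 < (q - 2) / (q - 1) := div_pos (by linarith) (by linarith)
    have he : 0 ≤ 1 / (q - 2) := one_div_nonneg.2 (by linarith)
    have hpos : ∀ s, 0 ≤ s → s < T → 0 < N s := fun s hs hsT =>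
      lt_of_le_of_ne (H.nonneg s hs) fun h' => not_le.2 hsT ((hTz s hs).1 h'.symm)
    have hNt := Real.rpow_nonneg (H.nonneg t ht.le) ((q - 2) / q)
    rw [ek]
    suffices h : N 0 ^ ((q - 2) / q) - (q - 2) / (q - 1) * l₀ * t ≤ N t ^ ((q - 2) / q) ∧
        N t ^ ((q - 2) / q) ≤ max (N 0 ^ ((q - 2) / q) - (q - 2) / (q - 1) * l₁ * t) 0 by
      constructor
      · refine Real.rpow_le_rpow (le_max_right _ _) (max_le ?_ hNt) he
        linarith [h.1]
      · refine Real.rpow_le_rpow hNt (h.2.trans_eq ?_) he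
        congr 1
        ring
    rcases le_or_gt T t with h | h
    · obtain ⟨r, hr₁, hr₀, e⟩ := H.exists_mean le_rfl hT (fun τ hτ => hpos τ hτ.1 hτ.2)
        (Or.inr hq2)
      have hz : (0 : ℝ) ^ ((q - 2) / q) = 0 :=
        Real.zero_rpow (div_pos (by linarith) hq0).ne'
      rw [(hTz T hT.le).2 le_rfl, hz, sub_zero] at e
      rw [(hTz t ht.le).2 h, hz]
      refine ⟨?_, le_max_right _ _⟩
      have hl₀ : 0 < l₀ := hl₁.trans_le hl
      have : (q - 2) / (q - 1) * r * T ≤ (q - 2) / (q - 1) * l₀ * t := by gcongr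
      linarith
    · obtain ⟨r, hr₁, hr₀, e⟩ := H.exists_mean le_rfl ht
        (fun τ hτ => hpos τ hτ.1 (hτ.2.trans h)) (Or.inr hq2)
      rw [sub_zero] at e
      rw [e]
      have h₁ : (q - 2) / (q - 1) * r * t ≤ (q - 2) / (q - 1) * l₀ * t := by gcongr
      have h₂ : (q - 2) / (q - 1) * l₁ * t ≤ (q - 2) / (q - 1) * r * t := by gcongr
      exact ⟨by linarith, le_max_of_le_left (by linarith)⟩

end IsDecay

/-! ### From the scheme to the flow -/

section Solution

variable {θ q h C : ℝ} {M : ℕ} {u₀ : ℤ → ℝ} {v : ℝ → ℤ → ℝ}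

theorem IsSolution.eq_zero (hv : IsSolution θ q h M u₀ v) {t : ℝ} (ht : 0 ≤ t) :
    ∀ i ∉ grid M, v t i = 0 := fun i hi =>
  hv.boundary i (by rwa [mem_grid, not_le] at hi) t ht

theorem IsSolution.zero_eq (hv : IsSolution θ q h M u₀ v)
    (hu₀ : ∀ i : ℤ, (M : ℤ) < |i| → u₀ i = 0) : v 0 = u₀ := by
  funext i
  rcases le_or_gt |i| (M : ℤ) with hi | hi
  · exact hv.initial i hi
  · rw [hu₀ i hi, hv.boundary i hi 0 le_rfl]

theorem IsSolution.continuousOn (hv : IsSolution θ q h M u₀ v) (hq : 1 < q) (i : ℤ) :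
    ContinuousOn (fun t => v t i) (Ici 0) := by
  have hp : 0 < q - 1 := by linarith
  have hy : ContinuousOn (fun t => oddPow (v t i) (q - 1)) (Ici 0) := by
    intro t (ht : 0 ≤ t)
    have hc := (hv.absCont i (t + 1) (by linarith)).continuousOn
    rw [uIcc_of_le (by linarith)] at hc
    refine (hc t ⟨ht, by linarith⟩).mono_of_mem_nhdsWithin ?_
    filter_upwards [self_mem_nhdsWithin,
      mem_nhdsWithin_of_mem_nhds (gt_mem_nhds (lt_add_one t))] with s h₁ h₂
    exact ⟨h₁, h₂.le⟩
  refine ((continuous_oddPow (one_div_pos.2 hp)).comp_continuousOn hy).congr fun t _ => ?_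
  exact (oddPow_oddPow_inv hp.ne' _).symm

/-- A solution of the scheme is a classical solution at positive times. -/
theorem IsSolution.isFlow (hv : IsSolution θ q h M u₀ v) (hw : Summable (weight θ h))
    (hq : 1 < q) : IsFlow (grid M) (stiffness θ h) q v := by
  refine ⟨fun i _ => hv.continuousOn hq i, fun i hi t ht => ?_⟩
  set y := fun t => oddPow (v t i) (q - 1)
  set g := fun t => -matVec (grid M) (stiffness θ h) (v t) i with hg
  have hgc : ContinuousOn g (Ici 0) := (continuousOn_finsetSum _ fun k _ =>
    continuousOn_const.mul (hv.continuousOn hq k)).neg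
  have hode : ∀ᵐ s, 0 < s → deriv y s = g s := by
    have := (ae_restrict_iff' measurableSet_Ioi).1 (hv.ode i (mem_grid.1 hi))
    filter_upwards [this] with s hs hs0
    rw [(hs hs0).deriv, discFracLap_eq_sum hw (hv.eq_zero (le_of_lt hs0)) hi]
    rfl
  -- Absolute continuity turns the almost-everywhere equation into an integral identity; as g is
  -- continuous, the derivative then exists at every positive time.
  have hint : ∀ s, 0 < s → y s = y 0 + ∫ τ in (0 : ℝ)..s, g τ := fun s hs => by
    have h₁ := (hv.absCont i s hs).integral_deriv_eq_sub
    have h₂ : ∫ τ in (0 : ℝ)..s, deriv y τ = ∫ τ in (0 : ℝ)..s, g τ := by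
      refine intervalIntegral.integral_congr_ae ?_
      filter_upwards [hode] with τ hτ hτs
      rw [uIoc_of_le hs.le] at hτs
      exact hτ hτs.1
    rw [← h₂, h₁]
    simp [y]
  have hgt : ContinuousAt g t := hgc.continuousAt (Ici_mem_nhds ht)
  have hd : HasDerivAt (fun s => y 0 + ∫ τ in (0 : ℝ)..s, g τ) (g t) t := by
    refine (intervalIntegral.integral_hasDerivAt_right ?_ ?_ hgt).const_add _
    · refine ContinuousOn.intervalIntegrable (hgc.mono ?_)
      rw [uIcc_of_le ht.le]
      exact fun s hs => hs.1
    · exact (hgc.mono fun s (hs : 0 < s) => le_of_lt hs).stronglyMeasurableAtFilter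
        isOpen_Ioi t ht
  refine hd.congr_of_eventuallyEq ?_
  filter_upwards [lt_mem_nhds ht] with s hs
  exact hint s hs

theorem mass_rpow_eq_lqNorm (hq : 0 < q) {f : ℤ → ℝ} (hf : ∀ i ∉ grid M, f i = 0) :
    mass (grid M) q h f ^ (1 / q) = lqNorm q h f :=
  (lqNorm_eq_sum hq hf).symm

theorem mass_eq_zero_iff (hh : 0 < h) (hq : 0 < q) {f : ℤ → ℝ} (hf : ∀ i ∉ grid M, f i = 0) :
    mass (grid M) q h f = 0 ↔ f = 0 := by
  rw [← not_iff_not, ← ne_eq, ← ne_eq, ← sum_rpow_pos_iff hh hq hf]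
  exact ⟨fun H => lt_of_le_of_ne (mass_nonneg hh.le f) H.symm, fun H => H.ne'⟩

theorem rayleigh_eq (hw : Summable (weight θ h)) (hw₀ : ∀ j, 0 ≤ weight θ h j) (hh : 0 < h)
    (hq : 0 < q) {f : ℤ → ℝ} (hf : ∀ i ∉ grid M, f i = 0) :
    rayleigh θ q h f
      = energy (grid M) (stiffness θ h) h f * mass (grid M) q h f ^ (-(2 / q)) := by
  rw [rayleigh, hSeminorm_sq hw hw₀ hh hf, ← mass_rpow_eq_lqNorm hq hf, ← Real.rpow_natCast,
    ← Real.rpow_mul (mass_nonneg hh.le f), Real.rpow_neg (mass_nonneg hh.le f), div_eq_mul_inv]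
  congr 3
  push_cast
  ring

theorem IsSolution.antitoneOn_rayleigh (hv : IsSolution θ q h M u₀ v)
    (hw : Summable (weight θ h)) (hw₀ : ∀ j, 0 ≤ weight θ h j) (hh : 0 < h) (hq : 1 < q) {T : ℝ} (hT : ∀ t ∈ Icc 0 T, v t ≠ 0) :
    AntitoneOn (fun t => rayleigh θ q h (v t)) (Icc 0 T) := by
  have hq0 : 0 < q := by linarith
  refine ((hv.isFlow hw hq).antitoneOn_quotient hq hh.le (stiffness_comm θ h)
    (quadForm_nonneg hw hw₀ hh) fun t ht => ?_).congr fun t ht => ?_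
  · exact (sum_rpow_pos_iff hh hq0 (hv.eq_zero ht.1)).2 (hT t ht)
  · exact (rayleigh_eq hw hw₀ hh hq0 (hv.eq_zero ht.1)).symm

theorem IsSolution.isDecay (hv : IsSolution θ q h M u₀ v) (hw : Summable (weight θ h))
    (hw₀ : ∀ j, 0 ≤ weight θ h j) (hh : 0 < h) (hq : 1 < q) (hC : 0 < C) (hPS : IsPoincareSobolevConst θ q h M C)
    (h₀ : v 0 ≠ 0) :
    IsDecay q (rayleigh θ q h (v 0)) (C ^ (-2 : ℤ)) (fun t => mass (grid M) q h (v t))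
      (fun t => rayleigh θ q h (v t)) := by
  have hq0 : 0 < q := by linarith
  have hF := hv.isFlow hw hq
  refine ⟨hq, by positivity, hF.continuousOn_mass hq0.le,
    (sum_rpow_pos_iff hh hq0 (hv.eq_zero le_rfl)).2 h₀, fun t _ => mass_nonneg hh.le _,
    fun t ht => ?_, fun t ht hN => ?_, fun t ht hN => ?_⟩
  · refine (hF.hasDerivAt_mass hq ht).congr_deriv ?_
    have hs := hv.eq_zero ht.le
    congr 1
    -- After extinction the Rayleigh quotient is 0/0 = 0, and the equation for the mass still holds
    -- because both sides vanish.
    rcases (mass_nonneg hh.le (v t) : 0 ≤ mass (grid M) q h (v t)).eq_or_lt with h0 | h0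
    · rw [← h0, Real.zero_rpow (div_ne_zero two_ne_zero hq0.ne'),
        (mass_eq_zero_iff hh hq0 hs).1 h0.symm]
      simp [energy]
    · rw [rayleigh_eq hw hw₀ hh hq0 hs, mul_assoc, ← Real.rpow_add h0]
      simp
  · refine hv.antitoneOn_rayleigh hw hw₀ hh hq (T := t) (fun s hs => ?_) ⟨le_rfl, ht⟩
      ⟨ht, le_rfl⟩ ht
    exact (sum_rpow_pos_iff hh hq0 (hv.eq_zero hs.1)).1 (hN s hs)
  · exact inv_sq_le_rayleigh hw hh hq0 hC hPS (hv.eq_zero ht)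
      ((sum_rpow_pos_iff hh hq0 (hv.eq_zero ht)).1 hN)

end Solution

end FracDiff

end

theorem mainTheorem2
    (θ q h C : ℝ) (M : ℕ) (u₀ : ℤ → ℝ) (v : ℝ → ℤ → ℝ)
    (hθ : 0 < θ) (hθ' : θ < 1) (hh : 0 < h) (hM : 1 ≤ M)
    (hq : 1 < q) (hq' : ENNReal.ofReal q ≤ FracDiff.twoStar θ)
    (hu₀ : ∀ i : ℤ, (M : ℤ) < |i| → u₀ i = 0) (hu₀' : u₀ ≠ 0)
    (hC : 0 < C) (hPS : FracDiff.IsPoincareSobolevConst θ q h M C)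
    (hv : FracDiff.IsSolution θ q h M u₀ v) :
    (q ≠ 2 → ∀ t : ℝ, 0 < t →
      (max (FracDiff.lqNorm q h u₀ ^ (-(2 - q))
          + (2 - q) / (q - 1) * FracDiff.rayleigh θ q h u₀ * t) 0) ^ (-1 / (2 - q))
        ≤ FracDiff.lqNorm q h (v t) ∧
      FracDiff.lqNorm q h (v t) ≤
        (max (FracDiff.lqNorm q h u₀ ^ (-(2 - q))
          + (2 - q) / (q - 1) * C ^ (-2 : ℤ) * t) 0) ^ (-1 / (2 - q))) ∧
    (q ≤ 2 → (∀ t : ℝ, 0 ≤ t → v t ≠ 0) ∧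
      AntitoneOn (fun t => FracDiff.rayleigh θ q h (v t)) (Ici 0)) ∧
    (2 < q → ∃ tStar : ℝ, 0 < tStar ∧
      (∀ t : ℝ, 0 ≤ t → (v t = 0 ↔ tStar ≤ t)) ∧
      (∀ t : ℝ, 0 < t →
        (max ((q - 2) / (q - 1) * C ^ (-2 : ℤ) * (tStar - t)) 0) ^ (1 / (q - 2))
          ≤ FracDiff.lqNorm q h (v t) ∧
        FracDiff.lqNorm q h (v t) ≤
          (max ((q - 2) / (q - 1) * FracDiff.rayleigh θ q h u₀ * (tStar - t)) 0)
            ^ (1 / (q - 2))) ∧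
      AntitoneOn (fun t => FracDiff.rayleigh θ q h (v t)) (Ico 0 tStar)) := by
  have hw := FracDiff.summable_weight hθ hθ' h
  have hw₀ := FracDiff.weight_nonneg hθ hθ' hh.le
  have hq0 : 0 < q := by linarith
  have h0 := hv.zero_eq hu₀
  subst h0
  have H := hv.isDecay hw hw₀ hh hq hC hPS hu₀'
  have hnorm : ∀ t, 0 ≤ t → FracDiff.mass (FracDiff.grid M) q h (v t) ^ (1 / q)
      = FracDiff.lqNorm q h (v t) := fun t ht =>
    FracDiff.mass_rpow_eq_lqNorm hq0 (hv.eq_zero ht)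
  have hzero : ∀ t, 0 ≤ t → (FracDiff.mass (FracDiff.grid M) q h (v t) = 0 ↔ v t = 0) :=
    fun t ht => FracDiff.mass_eq_zero_iff hh hq0 (hv.eq_zero ht)
  refine ⟨fun hq2 t ht => ?_, fun hq2 => ?_, fun hq2 => ?_⟩
  · have e : FracDiff.lqNorm q h (v 0) ^ (-(2 - q))
        = FracDiff.mass (FracDiff.grid M) q h (v 0) ^ ((q - 2) / q) := by
      rw [← hnorm 0 le_rfl, ← Real.rpow_mul (FracDiff.mass_nonneg hh.le _)]
      congr 1
      field_simp
      ring
    rw [e, ← hnorm t ht.le]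
    exact H.decay_bounds hq2 ht
  · have hne : ∀ t : ℝ, 0 ≤ t → v t ≠ 0 := fun t ht h' =>
      (H.pos_of_le_two hq2 ht).ne' ((hzero t ht).2 h')
    refine ⟨hne, fun s hs t ht hst => ?_⟩
    exact hv.antitoneOn_rayleigh hw hw₀ hh hq (T := t) (fun τ hτ => hne τ hτ.1) ⟨hs, hst⟩
      ⟨ht, le_rfl⟩ hst
  · obtain ⟨T, hT, hTz⟩ := H.exists_extinction hq2
    have hTv : ∀ t : ℝ, 0 ≤ t → (v t = 0 ↔ T ≤ t) := fun t ht =>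
      (hzero t ht).symm.trans (hTz t ht)
    refine ⟨T, hT, hTv, fun t ht => ?_, fun s hs t ht hst => ?_⟩
    · rw [← hnorm t ht.le]
      exact H.extinction_bounds hq2 hT hTz ht.le
    · exact hv.antitoneOn_rayleigh hw hw₀ hh hq (T := t)
        (fun τ hτ h' => not_le.2 (hτ.2.trans_lt ht.2) ((hTv τ hτ.1).1 h')) ⟨hs.1, hst⟩
        ⟨ht.1, le_rfl⟩ hst
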